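/- Let $G$ be a finite group and $\chi$ an irreducible complex character of $G$ of even degree $\chi(1)=2m$ with Frobenius–Schur indicator $o$ (i.e. $\chi$ is not real valued). Let $L=\mathbb{Q}(\chi)$ be the character field and $K=L\cap\mathbb{R}$ its real subfield. Assume that $\chi$ is afforded by an $L$-representation $\rho:G\to \mathrm{GL}(V)$, and let $H:V\times V\to L$ be a non-degenerate $\rho(G)$-invariant $L/K$-Hermitian form, with adjoint involution $\iota_H$ on $\mathrm{End}_L(V)$. Let $\alpha\in\mathrm{Aut}(G)$ satisfy $\alpha^2=1$ and $\chi\circ\alpha=\overline{\chi}$, and assume that the character $\mathrm{Ind}_G^{G:\langle\alpha\rangle}(\chi)$ of the semidirect product $G:\langle\alpha\rangle$ has Frobenius–Schur indicator $+$. Let $$A=\langle \rho(g)+\rho(\alpha(g)) \mid g\in G\rangle_K\subseteq \mathrm{End}_L(V)$$ be the $\alpha$-fixed algebra, a central simple $K$-algebra of degree $2m$ on which $\iota_H$ restricts to an orthogonal involution. The $\alpha$-discriminant of $\chi$ is the discriminant of $\iota_H|_A$, i.e. the square class $(-1)^m N_{\mathrm{red}}(a)\,(K^\times)^2$ for any invertible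 $a\in A$ with $\iota_H(a)=-a$. Then such elements $a$ exist and the $\alpha$-discriminant is a well-defined square class $d\,(K^\times)^2$; and every (non-zero) prime ideal $\wp$ of the ring of integers of $K$ that ramifies in the $\alpha$-discriminant algebra $K[X]/(X^2-d)$ of $\chi$ divides $2|G|$. -/

import Mathlib

open scoped TensorProduct nonZeroDivisors ComplexConjugate Polynomial

noncomputable section

namespace AlphaDisc

/-! ### Ordinary characters and Frobenius-Schur indicators -/

/-- `τ` is a complex representation of `Γ` affording the character `χ`. -/
def Affords {Γ : Type*} [Group Γ] (χ : Γ → ℂ) {n : ℕ}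
    (τ : Representation ℂ Γ (Fin n → ℂ)) : Prop :=
  ∀ g, τ.character g = χ g

/-- `χ` is an irreducible ordinary (complex) character of `Γ`. -/
def IsIrrChar {Γ : Type*} [Group Γ] (χ : Γ → ℂ) : Prop :=
  ∃ (n : ℕ) (τ : Representation ℂ Γ (Fin n → ℂ)), τ.IsIrreducible ∧ Affords χ τ

/-- `χ` takes only real values. -/
def RealValued {Γ : Type*} (χ : Γ → ℂ) : Prop := ∀ g, conj (χ g) = χ g

/-- The bilinear form `B` is invariant under the representation `τ`. -/
def InvariantForm {Γ W : Type*} [Group Γ] [AddCommGroup W] [Module ℂ W]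
    (τ : Representation ℂ Γ W) (B : LinearMap.BilinForm ℂ W) : Prop :=
  ∀ g v w, B (τ g v) (τ g w) = B v w

/-- Frobenius-Schur indicator `+`: `χ` is real valued and a complex representation affording `χ`
carries a non-degenerate invariant quadratic form (given by its symmetric bilinear form). -/
def IndicatorPlus {Γ : Type*} [Group Γ] (χ : Γ → ℂ) : Prop :=
  RealValued χ ∧ ∃ (n : ℕ) (τ : Representation ℂ Γ (Fin n → ℂ)), Affords χ τ ∧
    ∃ B : LinearMap.BilinForm ℂ (Fin n → ℂ), B.IsSymm ∧ B.Nondegenerate ∧ InvariantForm τ B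

/-- `χ` is real valued and a complex representation affording `χ` carries a non-degenerate
invariant symplectic form. (For irreducible `χ` this is Frobenius-Schur indicator `-`.) -/
def IndicatorMinus {Γ : Type*} [Group Γ] (χ : Γ → ℂ) : Prop :=
  RealValued χ ∧ ∃ (n : ℕ) (τ : Representation ℂ Γ (Fin n → ℂ)), Affords χ τ ∧
    ∃ B : LinearMap.BilinForm ℂ (Fin n → ℂ), B.IsAlt ∧ B.Nondegenerate ∧ InvariantForm τ B

/-- Frobenius-Schur indicator `o`: all other cases. -/
def IndicatorO {Γ : Type*} [Group Γ] (χ : Γ → ℂ) : Prop :=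
  ¬ IndicatorPlus χ ∧ ¬ IndicatorMinus χ

/-! ### The extended group and the induced character -/

/-- The semidirect product `G : ⟨α⟩`. -/
abbrev ExtGroup {G : Type*} [Group G] (α : MulAut G) : Type _ :=
  G ⋊[(Subgroup.zpowers α).subtype] (Subgroup.zpowers α)

/-- The character of `G : ⟨α⟩` induced from `χ`:
`x ↦ |G|⁻¹ ∑ y, χ°(y x y⁻¹)`, with `χ°` equal to `χ` on `G` and to `0` off `G`. -/
def inducedChar {G : Type*} [Group G] (χ : G → ℂ) (α : MulAut G) (x : ExtGroup α) : ℂ :=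
  open Classical in
  (Nat.card G : ℂ)⁻¹ * ∑ᶠ y : ExtGroup α,
    if (y * x * y⁻¹).right = 1 then χ (y * x * y⁻¹).left else 0

/-! ### The character field and its real subfield -/

/-- The character field `L = ℚ(χ)`. -/
abbrev charField {G : Type*} (χ : G → ℂ) : IntermediateField ℚ ℂ :=
  IntermediateField.adjoin ℚ (Set.range χ)

/-- The real subfield `K = L⁺ = L ∩ ℝ` of the character field. -/
abbrev realField {G : Type*} (χ : G → ℂ) : Subfield (charField χ) :=
  Complex.ofRealHom.fieldRange.comap (algebraMap (charField χ) ℂ)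

/-! ### Invariant Hermitian forms -/

/-- `H` is a non-degenerate `L/K`-Hermitian form on the `L`-vector space `V`, invariant under the
representation `ρ`, where `L` is a subfield of `ℂ` and conjugation is complex conjugation. -/
structure IsInvariantHermitian {G V : Type*} [Group G] {L : IntermediateField ℚ ℂ}
    [AddCommGroup V] [Module L V] (ρ : Representation L G V) (H : V → V → L) : Prop where
  add_left : ∀ v v' w, H (v + v') w = H v w + H v' w
  smul_left : ∀ (a : L) v w, H (a • v) w = a * H v w
  conj_symm : ∀ v w, (H v w : ℂ) = conj (H w v : ℂ)
  nondegenerate : ∀ v, (∀ w, H v w = 0) → v = 0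
  invariant : ∀ g v w, H (ρ g v) (ρ g w) = H v w

/-- `a` is skew for the adjoint involution `ι_H` of `H`, i.e. `ι_H(a) = -a`; here `ι_H(a)` is
determined by `H (a v) w = H v (ι_H(a) w)`. -/
def IsSkew {L V : Type*} [Field L] [AddCommGroup V] [Module L V] (H : V → V → L)
    (a : Module.End L V) : Prop :=
  ∀ v w, H (a v) w = H v ((-a) w)

/-! ### The fixed algebra -/

section FixedAlgebra

variable {G V L : Type*} [Group G] [Field L] (K : Subfield L)
  [AddCommGroup V] [Module L V] (ρ : Representation L G V) (α : MulAut G)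

/-- The `K`-span of the endomorphisms `ρ(g) + ρ(α(g))`. -/
def fixedSpan : Submodule K (Module.End L V) :=
  Submodule.span K (Set.range fun g => ρ g + ρ (α g))

theorem one_mem_fixedSpan [CharZero L] : (1 : Module.End L V) ∈ fixedSpan K ρ α := by
  have h : (2 : K)⁻¹ • (ρ 1 + ρ (α 1)) ∈ fixedSpan K ρ α :=
    Submodule.smul_mem _ _ (Submodule.subset_span ⟨1, rfl⟩)
  have h2 : (2 : K) ≠ 0 := two_ne_zero
  have e : ρ 1 + ρ (α 1) = (2 : K) • (1 : Module.End L V) := by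
    rw [map_one α, map_one ρ, two_smul]
  rwa [e, smul_smul, inv_mul_cancel₀ h2, one_smul] at h

theorem mul_mem_fixedSpan (hα : α ^ 2 = 1) {x y : Module.End L V}
    (hx : x ∈ fixedSpan K ρ α) (hy : y ∈ fixedSpan K ρ α) : x * y ∈ fixedSpan K ρ α := by
  have hαα : ∀ g, α (α g) = g := fun g => by
    have := congrArg (fun β : MulAut G => β g) hα
    simpa [pow_two] using this
  induction hx using Submodule.span_induction with
  | zero => simp
  | add a b _ _ ha hb => rw [add_mul]; exact Submodule.add_mem _ ha hb
  | smul c a _ ha => rw [smul_mul_assoc]; exact Submodule.smul_mem _ _ ha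
  | mem a ha =>
    obtain ⟨g, rfl⟩ := ha
    induction hy using Submodule.span_induction with
    | zero => simp
    | add a b _ _ ha hb => rw [mul_add]; exact Submodule.add_mem _ ha hb
    | smul c a _ ha => rw [mul_smul_comm]; exact Submodule.smul_mem _ _ ha
    | mem b hb =>
      obtain ⟨h, rfl⟩ := hb
      have e : (ρ g + ρ (α g)) * (ρ h + ρ (α h)) =
          (ρ (g * h) + ρ (α (g * h))) + (ρ (g * α h) + ρ (α (g * α h))) := by
        simp only [map_mul, hαα]
        noncomm_ring
      exact e ▸ Submodule.add_mem _ (Submodule.subset_span ⟨_, rfl⟩)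
        (Submodule.subset_span ⟨_, rfl⟩)

/-- The `α`-fixed algebra `Fix_α(ρ) = ⟨ρ(g) + ρ(α(g)) ∣ g ∈ G⟩_K`, a `K`-subalgebra of
`End_L(V)`. -/
def fixedAlgebra [CharZero L] (hα : α ^ 2 = 1) : Subalgebra K (Module.End L V) :=
  (fixedSpan K ρ α).toSubalgebra (one_mem_fixedSpan K ρ α)
    (fun _ _ hx hy => mul_mem_fixedSpan K ρ α hα hx hy)

end FixedAlgebra

/-! ### Reduced norms and discriminants of involutions -/

/-- `c` is the reduced norm of the element `a` of the central simple `K`-algebra `A`: over a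
splitting field `E` of `A`, the matrix corresponding to `1 ⊗ a` has determinant `c`. -/
def IsReducedNorm {K : Type} {A : Type*} [Field K] [Ring A] [Algebra K A] (a : A) (c : K) :
    Prop :=
  ∃ (E : Type) (_ : Field E) (_ : Algebra K E) (n : ℕ)
    (f : (E ⊗[K] A) ≃ₐ[E] Matrix (Fin n) (Fin n) E),
    (f (1 ⊗ₜ[K] a)).det = algebraMap K E c

/-- The square class `(-1)^m N_red(a) (Kˣ)²`, as a subset of `Kˣ`, for `a` ranging over the
invertible skew elements (the set of skew elements being `S`) of a central simple `K`-algebra `A`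
of degree `2m`. -/
def discClass (K : Type) {A : Type*} [Field K] [Ring A] [Algebra K A] (S : Set A) : Set Kˣ :=
  {d | ∃ (m : ℕ) (a : A) (c : K) (s : Kˣ), Module.finrank K A = (2 * m) ^ 2 ∧
    a ∈ S ∧ IsUnit a ∧ IsReducedNorm a c ∧ (d : K) = (-1) ^ m * c * (s : K) ^ 2}

/-- The `α`-discriminant of the character `χ` afforded by `ρ`: the discriminant of the restriction
of the adjoint involution of `H` to the `α`-fixed algebra, as a subset of `Kˣ`. -/
def alphaDisc {G V : Type*} [Group G] (χ : G → ℂ) [AddCommGroup V] [Module (charField χ) V]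
    (ρ : Representation (charField χ) G V) (H : V → V → charField χ)
    (α : MulAut G) (hα : α ^ 2 = 1) : Set (realField χ)ˣ :=
  discClass (realField χ)
    {a : fixedAlgebra (realField χ) ρ α hα | IsSkew H (a : Module.End (charField χ) V)}

/-! ### Quadratic étale algebras and ramification -/

/-- The étale algebra `K[X]/(X² - d)`. -/
abbrev quadAlgebra {K : Type*} [Field K] (d : K) : Type _ :=
  AdjoinRoot (Polynomial.X ^ 2 - Polynomial.C d : K[X])

/-- The prime ideal `v` of the ring of integers of `K` ramifies in the étale `K`-algebra `E`:
the integral closure of `𝓞 K` in `E` is not unramified over `v`. -/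
def RamifiesIn {K : Type*} [Field K] (v : IsDedekindDomain.HeightOneSpectrum
    (NumberField.RingOfIntegers K)) (E : Type*) [CommRing E] [Algebra K E] : Prop :=
  ¬ Algebra.IsUnramifiedIn
    (integralClosure (NumberField.RingOfIntegers K) E) v.asIdeal

end AlphaDisc

end

/-! Write `A` for the fixed algebra, `n = 2m` for the degree, and `δ = χ(g₀) - χ(α g₀)` for some
`g₀` where `χ` is not real. Then `End_L(V) = A ⊕ δA`, so `L` splits `A` and reduced norms are
determinants over `L`.

The bridge to `ι_H` is a nonzero `L`-bilinear form `B` with `B(gv, α(g)w) = B(v, w)`. It is unique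
up to scalars, hence symmetric or alternating, with sign given by `∑ χ(g α(g)) = ε|G|`
(`TwistedInvariant.sum_char`). Indicator `+` of the induced character forces `ε = 1`. On `A` the
adjoints of `B` and `H` agree (`exists_adjoint`), so if `S` is the Gram matrix of `B` and `a ∈ A` is
skew, then `S a` is a skew-symmetric matrix.

Well-definedness: for skew invertible `a` and skew `b`, the characteristic polynomial of `a⁻¹b` is
the square of a monic polynomial, which descends to `K`; so the determinants differ by a square of
`K` (`exists_det_eq_mul_sq`).

Ramification: `det S * det a` is a square in `L`, so the parity of the valuation of the discriminant
is that of `det S`. Away from `|G|` the group ring maps onto the full endomorphism order of a stable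
lattice. The adjoint of `B` preserves this order, so `S` is a scalar times an invertible integral
matrix, and its determinant has even valuation because `n` is even
(`isSquare_valuation_det_twisted`). As `L` lies in the `|G|`-th cyclotomic field, `L/K` is
unramified there and the parity descends to `K`. An element of even valuation at a prime not above 2
gives an unramified quadratic algebra. -/

noncomputable section
namespace AlphaDisc

/-! ### Skew-symmetric matrices and characteristic polynomials -/

section LinearAlgebra
open Matrix Polynomial

/-- The determinant of a skew-symmetric matrix over a field of characteristic zero is a square. -/
theorem isSquare_det_of_skew {F : Type*} [Field F] [CharZero F] :
    ∀ (k : ℕ) {n : Type} [Fintype n] [DecidableEq n] (M : Matrix n n F),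
      Fintype.card n = k → Mᵀ = -M → IsSquare M.det := by
  intro k
  induction k using Nat.strong_induction_on with
  | _ k ih =>
  intro n _ _ M hk hM
  have hskew : ∀ i j, M i j = -M j i := fun i j => by
    have := congrFun (congrFun hM j) i
    simpa using this
  have hdiag : ∀ i, M i i = 0 := fun i => self_eq_neg.1 (hskew i i)
  by_cases hM0 : M = 0
  · subst hM0
    rcases isEmpty_or_nonempty n with h | h
    · simp
    · rw [Matrix.det_zero]; exact IsSquare.zero
  obtain ⟨i, j, hij⟩ : ∃ i j, M i j ≠ 0 := by
    by_contra! h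
    exact hM0 (by ext i j; simp [h])
  have hne : i ≠ j := fun h => hij (h ▸ hdiag i)
  -- Split off the block on `{i, j}`. Its determinant is the square of a nonzero entry, and its
  -- Schur complement is a smaller skew-symmetric matrix.
  let p : n → Prop := fun x => x = i ∨ x = j
  have hp2 : Fintype.card {x // p x} = 2 := by
    rw [Fintype.card_subtype]
    have : (Finset.univ.filter p) = {i, j} := by ext; simp [p]
    rw [this, Finset.card_pair hne]
  have hcard : Fintype.card {x // ¬ p x} < k := by
    have := Fintype.card_subtype_compl p
    have h3 := Fintype.card_subtype_le p
    omega
  let e : {x // p x} ⊕ {x // ¬ p x} ≃ n := Equiv.sumCompl p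
  let A := M.submatrix (Subtype.val : {x // p x} → n) (Subtype.val : {x // p x} → n)
  let B := M.submatrix (Subtype.val : {x // p x} → n) (Subtype.val : {x // ¬ p x} → n)
  let C := M.submatrix (Subtype.val : {x // ¬ p x} → n) (Subtype.val : {x // p x} → n)
  let D := M.submatrix (Subtype.val : {x // ¬ p x} → n) (Subtype.val : {x // ¬ p x} → n)
  have hMe : M.submatrix e e = fromBlocks A B C D := by
    ext (x | x) (y | y) <;> rfl
  have hA : Aᵀ = -A := by ext x y; exact hskew _ _
  have hD : Dᵀ = -D := by ext x y; exact hskew _ _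
  have hCB : Cᵀ = -B := by ext x y; exact hskew _ _
  have hBC : Bᵀ = -C := by ext x y; exact hskew _ _
  let u : {x // p x} ≃ Fin 2 := Fintype.equivFinOfCardEq hp2
  have hdetA : A.det = (A (u.symm 0) (u.symm 1)) ^ 2 := by
    rw [← det_submatrix_equiv_self u.symm A, det_fin_two]
    simp only [submatrix_apply]
    have h1 : A (u.symm 0) (u.symm 0) = 0 := hdiag _
    have h2 : A (u.symm 1) (u.symm 0) = - A (u.symm 0) (u.symm 1) := hskew _ _
    rw [h1, h2]; ring
  have hA0 : A (u.symm 0) (u.symm 1) ≠ 0 := by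
    have h2 : A (u.symm 1) (u.symm 0) = - A (u.symm 0) (u.symm 1) := hskew _ _
    intro h0
    have key : ∀ s t : Fin 2, A (u.symm s) (u.symm t) = 0 := by
      intro s t
      fin_cases s <;> fin_cases t
      · exact hdiag _
      · exact h0
      · simpa [h0] using h2
      · exact hdiag _
    have := key (u ⟨i, Or.inl rfl⟩) (u ⟨j, Or.inr rfl⟩)
    simp only [Equiv.symm_apply_apply] at this
    exact hij this
  have hAu : IsUnit A.det := by
    rw [hdetA]; exact (pow_ne_zero 2 hA0).isUnit
  let _ : Invertible A := invertibleOfIsUnitDet A hAu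
  rw [← det_submatrix_equiv_self e M, hMe, det_fromBlocks₁₁]
  refine IsSquare.mul ⟨_, by rw [hdetA, pow_two]⟩ (ih _ hcard _ rfl ?_)
  have hAi : (⅟A)ᵀ = -⅟A := by
    rw [invOf_eq_nonsing_inv, transpose_nonsing_inv, hA]
    refine inv_eq_left_inv ?_
    rw [neg_mul_neg, nonsing_inv_mul _ hAu]
  rw [transpose_sub, transpose_mul, transpose_mul, hD, hCB, hBC, hAi]
  rw [Matrix.neg_mul, Matrix.mul_neg, Matrix.neg_mul, neg_neg, Matrix.mul_assoc]
  abel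

/-- If `S` and `M` are skew-symmetric and `S` is invertible, then the characteristic polynomial of
`S⁻¹ * M` is the square of a monic polynomial. -/
theorem exists_monic_charpoly_eq_sq {F : Type*} [Field F] [CharZero F] {n : Type} [Fintype n]
    [DecidableEq n] (S M : Matrix n n F) (hS : Sᵀ = -S) (hM : Mᵀ = -M) (hSu : IsUnit S.det) :
    ∃ p : F[X], p.Monic ∧ (S⁻¹ * M).charpoly = p ^ 2 := by
  obtain ⟨s, hs⟩ := isSquare_det_of_skew _ S rfl hS
  have hs0 : s ≠ 0 := by rintro rfl; simp [hs] at hSu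
  -- `det (X S - M)` is `det S` times the wanted polynomial, and `X S - M` is skew over the fraction
  -- field of `F[X]`. The resulting square root there is integral over `F[X]`, hence a polynomial.
  let N : Matrix n n F[X] := (X : F[X]) • S.map C - M.map C
  have hN : C S.det * (S⁻¹ * M).charpoly = N.det := by
    have h1 : C S.det = (S.map C).det := by
      rw [← RingHom.mapMatrix_apply, ← RingHom.map_det]
    rw [h1, charpoly, ← det_mul]
    congr 1
    rw [charmatrix, mul_sub, RingHom.mapMatrix_apply, ← Matrix.map_mul, ← Matrix.mul_assoc,
      mul_nonsing_inv _ hSu, Matrix.one_mul]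
    congr 1
    rw [Matrix.scalar_apply, ← Matrix.smul_one_eq_diagonal, Matrix.mul_smul, Matrix.mul_one]
  let ι := algebraMap F[X] (FractionRing F[X])
  have : CharZero (FractionRing F[X]) := charZero_of_injective_algebraMap
    (IsFractionRing.injective F[X] (FractionRing F[X]))
  have hNs : (N.map ι)ᵀ = -(N.map ι) := by
    have e1 : ∀ i j, S j i = -S i j := fun i j => congrFun (congrFun hS i) j
    have e2 : ∀ i j, M j i = -M i j := fun i j => congrFun (congrFun hM i) j
    ext i j
    simp only [N, transpose_apply, map_apply, Matrix.sub_apply, Matrix.smul_apply, Matrix.neg_apply]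
    rw [e1 i j, e2 i j, ← map_neg ι, map_neg C, map_neg C, smul_eq_mul, smul_eq_mul]
    congr 1
    ring
  obtain ⟨q, hq⟩ := isSquare_det_of_skew _ (N.map ι) rfl hNs
  have hq' : ι N.det = q * q := by
    rw [← hq, RingHom.map_det]; rfl
  have hcs : ι (C s) ≠ 0 := by
    rw [Ne, map_eq_zero_iff _ (IsFractionRing.injective F[X] (FractionRing F[X])), C_eq_zero]
    exact hs0
  have hsq : (q / ι (C s)) ^ 2 = ι (S⁻¹ * M).charpoly := by
    rw [div_pow, div_eq_iff (pow_ne_zero _ hcs), pow_two q, ← hq', ← hN, hs, map_mul, C_mul,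
      map_mul]
    ring
  have hint : IsIntegral F[X] (q / ι (C s)) := by
    refine IsIntegral.of_pow (n := 2) two_pos ?_
    rw [hsq]
    exact isIntegral_algebraMap
  obtain ⟨p, hp⟩ := IsIntegrallyClosed.isIntegral_iff.1 hint
  have hp2 : (S⁻¹ * M).charpoly = p ^ 2 := by
    apply IsFractionRing.injective F[X] (FractionRing F[X])
    rw [map_pow, hp, hsq]
  have hlead : p.leadingCoeff ^ 2 = 1 := by
    rw [← leadingCoeff_pow, ← hp2]
    exact charpoly_monic _
  rcases sq_eq_one_iff.1 hlead with h | h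
  · exact ⟨p, h, hp2⟩
  · exact ⟨-p, by rw [Monic, leadingCoeff_neg, h, neg_neg], by rw [hp2, neg_sq]⟩

/-- Divisibility of `n`-th powers in `F[X]` implies divisibility of the bases. This transfers facts
about the characteristic polynomial of left multiplication to its `n`-th root, the reduced
characteristic polynomial. -/
theorem eq_of_monic_of_pow_eq {F : Type*} [Field F] {P Q : F[X]} (hP : P.Monic) (hQ : Q.Monic)
    {n : ℕ} (hn : n ≠ 0) (h : P ^ n = Q ^ n) : P = Q := by
  classical
  refine eq_of_monic_of_associated hP hQ (associated_of_dvd_dvd ?_ ?_)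
  · exact (UniqueFactorizationMonoid.pow_dvd_pow_iff_dvd hn).1 h.dvd
  · exact (UniqueFactorizationMonoid.pow_dvd_pow_iff_dvd hn).1 h.symm.dvd

theorem charpoly_blockDiagonal_const {F : Type*} [CommRing F] {n o : Type*} [Fintype n]
    [DecidableEq n] [Fintype o] [DecidableEq o] (M : Matrix n n F) :
    (blockDiagonal fun _ : o => M).charpoly = M.charpoly ^ Fintype.card o := by
  have : charmatrix (blockDiagonal fun _ : o => M) = blockDiagonal fun _ : o => charmatrix M := by
    ext ⟨i, k⟩ ⟨j, l⟩
    by_cases h : k = l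
    · subst h
      by_cases h' : i = j
      · subst h'; simp [blockDiagonal_apply]
      · simp [blockDiagonal_apply, h']
    · simp [blockDiagonal_apply, h]
  rw [charpoly, this, det_blockDiagonal, Finset.prod_const, Finset.card_univ]
  rfl

/-- In the basis of matrix units, left multiplication by `M` acts on each column separately, so its
matrix is block diagonal. -/
theorem charpoly_mulLeft_matrix {F : Type*} [Field F] {n : Type*} [Fintype n]
    [DecidableEq n] (M : Matrix n n F) :
    (LinearMap.mulLeft F M).charpoly = M.charpoly ^ Fintype.card n := by
  rw [← charpoly_blockDiagonal_const,
    ← LinearMap.charpoly_toMatrix _ (Matrix.stdBasis F n n)]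
  congr 1
  ext ⟨i, k⟩ ⟨j, l⟩
  rw [LinearMap.toMatrix_apply, LinearMap.mulLeft_apply, Matrix.stdBasis_eq_single,
    blockDiagonal_apply]
  have : (Matrix.stdBasis F n n).coord (i, k) = Matrix.entryLinearMap F F i k := by
    refine (Matrix.stdBasis F n n).ext fun ⟨a, b⟩ => ?_
    rw [Module.Basis.coord_apply, Module.Basis.repr_self, Matrix.stdBasis_eq_single,
      Matrix.entryLinearMap_apply, Finsupp.single_apply, Matrix.single_apply]
    simp
  rw [← Module.Basis.coord_apply, this, Matrix.entryLinearMap_apply]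
  by_cases h : k = l
  · subst h; simp
  · simp [h]

/-- The characteristic polynomial of left multiplication by an element of an algebra that becomes a
matrix algebra of degree `n` after scalar extension is the `n`-th power of the characteristic
polynomial of the corresponding matrix. -/
theorem map_charpoly_mulLeft_eq {K E A : Type*} [Field K] [Field E] [Algebra K E] [Ring A]
    [Algebra K A] [FiniteDimensional K A] {n : ℕ}
    (f : (E ⊗[K] A) ≃ₐ[E] Matrix (Fin n) (Fin n) E) (a : A) :
    (LinearMap.mulLeft K a).charpoly.map (algebraMap K E) = (f (1 ⊗ₜ[K] a)).charpoly ^ n := by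
  have h := charpoly_mulLeft_matrix (f (1 ⊗ₜ[K] a))
  rw [Fintype.card_fin] at h
  rw [← h, ← LinearMap.charpoly_baseChange,
    ← LinearEquiv.charpoly_conj f.toLinearEquiv]
  congr 1
  refine LinearMap.ext fun x => ?_
  obtain ⟨y, rfl⟩ := f.surjective x
  rw [LinearEquiv.conj_apply_apply]
  simp only [LinearMap.mulLeft_apply, ← map_mul]
  change f _ = _
  congr 1
  change (LinearMap.baseChange E (LinearMap.mulLeft K a)) (f.symm (f y)) = _
  rw [AlgEquiv.symm_apply_apply]
  induction y with
  | zero => simp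
  | tmul x y => simp
  | add x y hx hy => simp [mul_add, hx, hy]

end LinearAlgebra

/-! ### Schur's lemma from the norm of the character -/

section Schur

variable {F G V W : Type*} [Field F] [CharZero F] [Group G] [Fintype G]
  [AddCommGroup V] [Module F V] [FiniteDimensional F V]
  [AddCommGroup W] [Module F W] [FiniteDimensional F W]

theorem sum_char_eq_card_mul_finrank (ρ : Representation F G V) (σ : Representation F G W) :
    ∑ g, σ.character g * ρ.character g⁻¹ =
      Nat.card G * (Module.finrank F (ρ.IntertwiningMap σ) : F) := by
  have h0 : (Nat.card G : F) ≠ 0 := Nat.cast_ne_zero.2 Nat.card_pos.ne'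
  let _ : Invertible (Nat.card G : F) := invertibleOfNonzero h0
  rw [← Representation.card_inv_mul_sum_char_mul_char_eq_finrank ρ σ, mul_inv_cancel_left₀ h0]

/-- If the scalar product of the characters is `1`, then the space of intertwining maps is a
line. -/
theorem intertwining_line {ρ : Representation F G V} {σ : Representation F G W}
    (h : ∑ g, σ.character g * ρ.character g⁻¹ = Nat.card G) :
    ∃ f : ρ.IntertwiningMap σ, f ≠ 0 ∧ ∀ f' : ρ.IntertwiningMap σ, ∃ c : F, c • f = f' := by
  have h0 : (Nat.card G : F) ≠ 0 := Nat.cast_ne_zero.2 Nat.card_pos.ne'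
  rw [sum_char_eq_card_mul_finrank, mul_eq_left₀ h0, Nat.cast_eq_one] at h
  exact finrank_eq_one_iff'.1 h

/-- If the scalar product of the characters is nonzero, there is a nonzero intertwining map. -/
theorem exists_intertwining_ne_zero {ρ : Representation F G V} {σ : Representation F G W}
    (h : ∑ g, σ.character g * ρ.character g⁻¹ ≠ 0) : ∃ f : ρ.IntertwiningMap σ, f ≠ 0 := by
  by_contra! h'
  have : Subsingleton (ρ.IntertwiningMap σ) := ⟨fun a b => by rw [h' a, h' b]⟩
  rw [sum_char_eq_card_mul_finrank, Module.finrank_zero_of_subsingleton] at h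
  simp at h

theorem intertwining_unique {ρ : Representation F G V} {σ : Representation F G W}
    (h : ∑ g, σ.character g * ρ.character g⁻¹ = Nat.card G) {f : V →ₗ[F] W}
    (hf : ∀ g v, f (ρ g v) = σ g (f v)) (hf0 : f ≠ 0) {f' : V →ₗ[F] W}
    (hf' : ∀ g v, f' (ρ g v) = σ g (f' v)) : ∃ c : F, f' = c • f := by
  obtain ⟨e, he, hline⟩ := intertwining_line h
  obtain ⟨a, ha⟩ := hline (f.intertwiningMap_of_isIntertwiningMap ρ σ hf)
  obtain ⟨b, hb⟩ := hline (f'.intertwiningMap_of_isIntertwiningMap ρ σ hf')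
  have ha' : ∀ v, a • e v = f v := fun v => DFunLike.congr_fun ha v
  have hb' : ∀ v, b • e v = f' v := fun v => DFunLike.congr_fun hb v
  have ha0 : a ≠ 0 := by
    rintro rfl
    exact hf0 (LinearMap.ext fun v => by rw [← ha' v]; simp)
  refine ⟨b * a⁻¹, LinearMap.ext fun v => ?_⟩
  rw [LinearMap.smul_apply, ← ha', ← hb', smul_smul, inv_mul_cancel_right₀ ha0]

variable {ρ : Representation F G V}
  (hs : ∑ g, ρ.character g * ρ.character g⁻¹ = (Nat.card G : F))
include hs

/-- The hypothesis `hs` is the form in which absolute irreducibility is used: it makes sense over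
any field of characteristic zero and passes between `L` and `ℂ`. On the zero space its left side
would vanish. -/
theorem finrank_cast_ne_zero : (Module.finrank F V : F) ≠ 0 := by
  intro h
  rw [Nat.cast_eq_zero] at h
  have := Module.finrank_zero_iff.1 h
  have h0 : ∀ g, ρ.character g = 0 := fun g => by
    rw [Representation.character, Subsingleton.elim (ρ g) 0, map_zero]
  simp only [h0, mul_zero, Finset.sum_const_zero] at hs
  exact Nat.cast_ne_zero.2 Nat.card_pos.ne' hs.symm

theorem exists_scalar_of_commute {f : Module.End F V} (hf : ∀ g, f * ρ g = ρ g * f) :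
    ∃ c : F, f = c • 1 := by
  have := finrank_cast_ne_zero hs
  have hne : (1 : Module.End F V) ≠ 0 := by
    intro h
    have := congrArg (LinearMap.trace F V) h
    rw [LinearMap.trace_one, map_zero] at this
    contradiction
  exact intertwining_unique hs (f := 1) (fun _ _ => rfl) hne
    (fun g v => LinearMap.congr_fun (hf g) v)

/-- The average commutes with the group, hence is a scalar, which the trace determines. -/
theorem sum_conj_eq (x : Module.End F V) :
    ∑ g, ρ g * x * ρ g⁻¹ =
      (Nat.card G * (Module.finrank F V : F)⁻¹ * LinearMap.trace F V x) • 1 := by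
  have hn := finrank_cast_ne_zero hs
  have hcomm : ∀ h, (∑ g, ρ g * x * ρ g⁻¹) * ρ h = ρ h * ∑ g, ρ g * x * ρ g⁻¹ := by
    intro h
    rw [Finset.sum_mul, Finset.mul_sum]
    refine Fintype.sum_equiv (Equiv.mulLeft h⁻¹) _ _ fun g => ?_
    simp only [Equiv.coe_mulLeft, map_mul, mul_inv_rev, inv_inv]
    have e : ρ h * ρ h⁻¹ = 1 := by rw [← map_mul, mul_inv_cancel, map_one]
    simp only [← mul_assoc, e, one_mul]
  obtain ⟨c, hc⟩ := exists_scalar_of_commute hs hcomm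
  have ht := congrArg (LinearMap.trace F V) hc
  rw [map_sum, map_smul, LinearMap.trace_one, smul_eq_mul] at ht
  have : ∀ g, LinearMap.trace F V (ρ g * x * ρ g⁻¹) = LinearMap.trace F V x := fun g => by
    rw [LinearMap.trace_mul_comm, ← mul_assoc, ← map_mul, inv_mul_cancel, map_one, one_mul]
  simp only [this, Finset.sum_const, Finset.card_univ, nsmul_eq_mul] at ht
  rw [hc, Nat.card_eq_fintype_card, mul_right_comm, ht, mul_inv_cancel_right₀ hn]

/-- The Schur relations for matrix coefficients. -/
theorem schur_relation (ψ : Module.Dual F V) (v w : V) :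
    ∑ g, ψ (ρ g⁻¹ w) • ρ g v = (Nat.card G * (Module.finrank F V : F)⁻¹ * ψ v) • w := by
  have h := LinearMap.congr_fun (sum_conj_eq hs (ψ.smulRight v)) w
  rw [LinearMap.trace_smulRight] at h
  simpa [LinearMap.sum_apply] using h

/-- Fourier inversion on the endomorphism ring. -/
theorem fourier_inversion (x : Module.End F V) :
    x = (Module.finrank F V * (Nat.card G : F)⁻¹) •
      ∑ g, LinearMap.trace F V (x * ρ g⁻¹) • ρ g := by
  have hn := finrank_cast_ne_zero hs
  have h0 : (Nat.card G : F) ≠ 0 := Nat.cast_ne_zero.2 Nat.card_pos.ne'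
  -- Rank-one endomorphisms suffice by linearity; for them the traces are matrix coefficients and
  -- the claim is the Schur relation.
  have key : ∀ (ψ : Module.Dual F V) (w : V), (ψ.smulRight w : Module.End F V) =
      (Module.finrank F V * (Nat.card G : F)⁻¹) •
      ∑ g, LinearMap.trace F V (ψ.smulRight w * ρ g⁻¹) • ρ g := by
    intro ψ w
    ext v
    have : ∀ g, LinearMap.trace F V (ψ.smulRight w * ρ g⁻¹) = ψ (ρ g⁻¹ w) := fun g => by
      have : ψ.smulRight w * ρ g⁻¹ = (ψ ∘ₗ ρ g⁻¹).smulRight w := by ext; simp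
      rw [this, LinearMap.trace_smulRight]; rfl
    simp only [this, LinearMap.smul_apply, LinearMap.sum_apply]
    rw [schur_relation hs, smul_smul, LinearMap.smulRight_apply]
    congr 1
    field_simp
  let b := Module.finBasis F V
  have hx : x = ∑ i, ((b.coord i).smulRight (x (b i)) : Module.End F V) := by
    refine b.ext fun j => ?_
    simp [LinearMap.sum_apply, Finsupp.single_apply, ite_smul]
  rw [hx]
  conv_lhs => enter [2, i]; rw [key]
  rw [← Finset.smul_sum, Finset.sum_comm]
  simp only [Finset.sum_mul, map_sum, Finset.sum_smul]

theorem span_range_eq_top : Submodule.span F (Set.range ρ) = ⊤ := by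
  refine eq_top_iff.2 fun x _ => ?_
  rw [fourier_inversion hs x]
  exact Submodule.smul_mem _ _ (Submodule.sum_mem _ fun g _ =>
    Submodule.smul_mem _ _ (Submodule.subset_span ⟨g, rfl⟩))

/-- A nonzero intertwining map out of an absolutely irreducible representation is injective. -/
theorem injective_of_intertwining {X : Type*} [AddCommGroup X] [Module F X]
    {f : V →ₗ[F] X} (hf0 : f ≠ 0) (hf : ∀ g v, f v = 0 → f (ρ g v) = 0) :
    Function.Injective f := by
  rw [injective_iff_map_eq_zero]
  intro v hv
  by_contra hv0
  have hall : ∀ x : Module.End F V, f (x v) = 0 := by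
    intro x
    have hx : x ∈ Submodule.span F (Set.range ρ) := span_range_eq_top hs ▸ Submodule.mem_top
    induction hx using Submodule.span_induction with
    | zero => simp
    | add a b _ _ ha hb => simp [ha, hb]
    | smul c a _ ha => simp [ha]
    | mem a ha => obtain ⟨g, rfl⟩ := ha; exact hf g v hv
  obtain ⟨ψ, hψ⟩ := Module.Projective.exists_dual_eq_one F hv0
  refine hf0 (LinearMap.ext fun w => ?_)
  simpa [hψ] using hall (ψ.smulRight w)

end Schur

/-! ### Twisted-invariant bilinear forms -/

section TwistedForms

variable {F G V : Type*} [Field F] [CharZero F] [Group G] [Fintype G]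
  [AddCommGroup V] [Module F V] [FiniteDimensional F V]

/-- The bilinear form `B` satisfies `B (g v) (α(g) w) = B v w`. -/
def TwistedInvariant (ρ : Representation F G V) (α : MulAut G) (B : LinearMap.BilinForm F V) :
    Prop :=
  ∀ g v w, B (ρ g v) (ρ (α g) w) = B v w

/-- The dual of the twist of `ρ` by `α`. -/
def twistedDual (ρ : Representation F G V) (α : MulAut G) :
    Representation F G (Module.Dual F V) :=
  Representation.dual (ρ.comp α.toMonoidHom)

theorem twistedDual_apply (ρ : Representation F G V) (α : MulAut G) (g : G)
    (ψ : Module.Dual F V) (v : V) : twistedDual ρ α g ψ v = ψ (ρ (α g⁻¹) v) := rfl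

/-- Twisted-invariant forms become intertwining maps into the twisted dual. When `χ ∘ α` is the dual
character, that dual has the character of `ρ`, so these maps form a line. -/
theorem twistedInvariant_iff {ρ : Representation F G V} {α : MulAut G}
    {B : LinearMap.BilinForm F V} :
    TwistedInvariant ρ α B ↔ ∀ g v, B (ρ g v) = twistedDual ρ α g (B v) := by
  constructor
  · intro h g v
    ext w
    rw [twistedDual_apply, ← h g v, ← Module.End.mul_apply, ← map_mul, ← map_mul, mul_inv_cancel,
      map_one, map_one, Module.End.one_apply]
  · intro h g v w
    rw [h, twistedDual_apply, ← Module.End.mul_apply, ← map_mul, ← map_mul, inv_mul_cancel,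
      map_one, map_one, Module.End.one_apply]

variable {ρ : Representation F G V} {α : MulAut G}

omit [CharZero F] [Fintype G] in
theorem twistedDual_character (hα : ∀ g, ρ.character (α g) = ρ.character g⁻¹) (g : G) :
    (twistedDual ρ α).character g = ρ.character g := by
  rw [twistedDual, Representation.char_dual]
  exact (hα g⁻¹).trans (by rw [inv_inv])

variable (hs : ∑ g, ρ.character g * ρ.character g⁻¹ = (Nat.card G : F))
  (hα : ∀ g, ρ.character (α g) = ρ.character g⁻¹)

theorem TwistedInvariant.flip {B : LinearMap.BilinForm F V} (hB : TwistedInvariant ρ α B)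
    (hα2 : α ^ 2 = 1) : TwistedInvariant ρ α B.flip := by
  intro g v w
  have : α (α g) = g := by
    have := congrArg (fun β : MulAut G => β g) hα2
    simpa [pow_two] using this
  have h := hB (α g) w v
  rwa [this] at h

include hs in
theorem TwistedInvariant.injective {B : LinearMap.BilinForm F V} (hB : TwistedInvariant ρ α B)
    (hB0 : B ≠ 0) : Function.Injective B :=
  injective_of_intertwining hs hB0 fun g v hv => by
    rw [twistedInvariant_iff.1 hB, hv, map_zero]

include hs hα

theorem exists_twistedInvariant :
    ∃ B : LinearMap.BilinForm F V, B ≠ 0 ∧ TwistedInvariant ρ α B := by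
  obtain ⟨f, hf, -⟩ := intertwining_line (ρ := ρ) (σ := twistedDual ρ α)
    (by simpa only [twistedDual_character hα] using hs)
  refine ⟨f.toLinearMap, fun h => hf (Representation.IntertwiningMap.ext h),
    twistedInvariant_iff.2 fun g v => f.isIntertwining _ _ g v⟩

theorem TwistedInvariant.unique {B B' : LinearMap.BilinForm F V} (hB : TwistedInvariant ρ α B)
    (hB0 : B ≠ 0) (hB' : TwistedInvariant ρ α B') : ∃ c : F, B' = c • B :=
  intertwining_unique (σ := twistedDual ρ α)
    (by simpa only [twistedDual_character hα] using hs)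
    (twistedInvariant_iff.1 hB) hB0 (twistedInvariant_iff.1 hB')

/-- Since `α² = 1`, the flipped form is again twisted-invariant, hence proportional to `B`; flipping
twice gives `ε² = 1`. -/
theorem TwistedInvariant.flip_eq {B : LinearMap.BilinForm F V} (hB : TwistedInvariant ρ α B)
    (hB0 : B ≠ 0) (hα2 : α ^ 2 = 1) : ∃ ε : F, (ε = 1 ∨ ε = -1) ∧ B.flip = ε • B := by
  obtain ⟨c, hc⟩ := hB.unique hs hα hB0 (hB.flip hα2)
  refine ⟨c, ?_, hc⟩
  have h2 : (c ^ 2 - 1) • B = 0 := by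
    ext v w
    have e1 : ∀ v w, B w v = c * B v w := fun v w => LinearMap.congr_fun₂ hc v w
    have : B v w = c * (c * B v w) := by rw [← e1 v w, ← e1 w v]
    simp only [LinearMap.smul_apply, smul_eq_mul, LinearMap.zero_apply]
    linear_combination -this
  rw [smul_eq_zero, or_iff_left hB0, sub_eq_zero] at h2
  exact sq_eq_one_iff.1 h2

omit hα in
/-- The twisted Frobenius-Schur formula. -/
theorem TwistedInvariant.sum_char {B : LinearMap.BilinForm F V} (hB : TwistedInvariant ρ α B)
    (hB0 : B ≠ 0) {ε : F} (hε : B.flip = ε • B) :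
    ∑ g, ρ.character (g * α g) = ε * Nat.card G := by
  have hn := finrank_cast_ne_zero hs
  let b := Module.finBasis F V
  have hinj := hB.injective hs hB0
  have hsurj : Function.Surjective B :=
    (LinearMap.injective_iff_surjective_of_finrank_eq_finrank
      (Subspace.dual_finrank_eq (K := F) (V := V)).symm).1 hinj
  -- The family `b'` is dual to `b` under `B`, so traces can be computed with `B`.
  choose b' hb' using fun i => hsurj (b.coord i)
  have htr : ∀ y : Module.End F V, LinearMap.trace F V y = ∑ i, B (b' i) (y (b i)) := by
    intro y
    rw [LinearMap.trace_eq_matrix_trace F b, Matrix.trace]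
    refine Finset.sum_congr rfl fun i _ => ?_
    rw [hb', Matrix.diag_apply, LinearMap.toMatrix_apply, Module.Basis.coord_apply]
  have hadj : ∀ g v w, B v (ρ (α g) w) = B (ρ g⁻¹ v) w := by
    intro g v w
    rw [← hB g (ρ g⁻¹ v) w, ← Module.End.mul_apply, ← map_mul, mul_inv_cancel, map_one,
      Module.End.one_apply]
  -- The Schur relations exchange the two arguments. With `v = b i` and `w = b' i` this produces `B
  -- (b i) (b' i)`, which is `ε` because `B (b' i) (b i) = 1`.
  have hsum : ∀ v w, ∑ g, B (ρ g⁻¹ w) (ρ g v) =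
      Nat.card G * (Module.finrank F V : F)⁻¹ * B v w := by
    intro v w
    have h1 : ∀ g, B (ρ g⁻¹ w) (ρ g v) = ∑ j, B (b j) (b.coord j (ρ g⁻¹ w) • ρ g v) := by
      intro g
      refine (congrArg (fun u => B u (ρ g v)) (b.sum_repr (ρ g⁻¹ w)).symm).trans ?_
      simp only [map_sum, LinearMap.sum_apply, map_smul, LinearMap.smul_apply,
        Module.Basis.coord_apply]
    have h2 : ∀ j, ∑ g, B (b j) (b.coord j (ρ g⁻¹ w) • ρ g v) =
        Nat.card G * (Module.finrank F V : F)⁻¹ * (b.repr v j * B (b j) w) := by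
      intro j
      rw [← map_sum, schur_relation hs, map_smul, smul_eq_mul, Module.Basis.coord_apply, mul_assoc]
    have h3 : B v w = ∑ j, b.repr v j * B (b j) w := by
      refine (congrArg (fun u => B u w) (b.sum_repr v).symm).trans ?_
      simp only [map_sum, LinearMap.sum_apply, map_smul, LinearMap.smul_apply, smul_eq_mul]
    simp only [h1]
    rw [Finset.sum_comm, h3, Finset.mul_sum]
    exact Finset.sum_congr rfl fun j _ => h2 j
  have : ∀ g, ρ.character (g * α g) = ∑ i, B (ρ g⁻¹ (b' i)) (ρ g (b i)) := by
    intro g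
    rw [Representation.char_mul_comm, Representation.character, htr]
    refine Finset.sum_congr rfl fun i _ => ?_
    rw [map_mul, Module.End.mul_apply, hadj]
  simp only [this]
  rw [Finset.sum_comm]
  simp only [hsum]
  have e1 : ∀ i, B (b i) (b' i) = ε := by
    intro i
    have h1 : B (b i) (b' i) = ε * B (b' i) (b i) := LinearMap.congr_fun₂ hε (b' i) (b i)
    rw [h1, hb', Module.Basis.coord_apply, Module.Basis.repr_self, Finsupp.single_eq_same, mul_one]
  simp only [e1, Finset.sum_const, Finset.card_univ, Fintype.card_fin, nsmul_eq_mul]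
  field_simp

end TwistedForms

/-! ### Frobenius-Schur indicators and the twisted sum -/

section Indicators

variable {G : Type*} [Group G] [Fintype G] {χ : G → ℂ}

theorem IsIrrChar.exists_rep (hχ : IsIrrChar χ) :
    ∃ (n : ℕ) (τ : Representation ℂ G (Fin n → ℂ)), (∀ g, τ.character g = χ g) ∧
      ∑ g, τ.character g * τ.character g⁻¹ = (Nat.card G : ℂ) := by
  obtain ⟨n, τ, hτ, hA⟩ := hχ
  refine ⟨n, τ, hA, ?_⟩
  have h0 : (Nat.card G : ℂ) ≠ 0 := Nat.cast_ne_zero.2 Nat.card_pos.ne'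
  let _ : Invertible (Nat.card G : ℂ) := invertibleOfNonzero h0
  have h := Representation.char_orthonormal τ τ
  have hne : Nonempty (Representation.Equiv τ τ) := ⟨Representation.Equiv.refl τ⟩
  rw [if_pos hne, inv_mul_eq_iff_eq_mul₀ h0, mul_one] at h
  exact h

/-- An irreducible character with Frobenius-Schur indicator `o` is orthogonal to its dual. -/
theorem sum_sq_eq_zero_of_indicatorO (hχ : IsIrrChar χ) (hO : IndicatorO χ)
    (hinv : ∀ g, χ g⁻¹ = conj (χ g)) : ∑ g, χ g * χ g = 0 := by
  obtain ⟨n, τ, hτ, hs⟩ := hχ.exists_rep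
  by_contra hne
  -- A nonzero sum yields a nonzero map from `τ` to its dual. This is a non-degenerate invariant
  -- form, symmetric or alternating, so the indicator would be `+` or `-`.
  have h1 : ∑ g, (twistedDual τ 1).character g * τ.character g⁻¹ ≠ 0 := by
    have : ∑ g, (twistedDual τ 1).character g * τ.character g⁻¹ = ∑ g, χ g * χ g := by
      refine Fintype.sum_equiv (Equiv.inv G) _ _ fun g => ?_
      rw [twistedDual, Representation.char_dual, hτ, Equiv.inv_apply, ← hτ]
      rfl
    rwa [this]
  obtain ⟨f, hf0⟩ := exists_intertwining_ne_zero h1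
  let B : LinearMap.BilinForm ℂ (Fin n → ℂ) := f.toLinearMap
  have hB0 : B ≠ 0 := fun h => hf0 (Representation.IntertwiningMap.ext h)
  have hB : TwistedInvariant τ 1 B :=
    twistedInvariant_iff.2 fun g v => f.isIntertwining _ _ g v
  have hinj := hB.injective hs hB0
  let e := LinearEquiv.ofBijective B ⟨hinj,
    (LinearMap.injective_iff_surjective_of_finrank_eq_finrank
      (Subspace.dual_finrank_eq (K := ℂ) (V := Fin n → ℂ)).symm).1 hinj⟩
  have hreal : ∀ g, χ g⁻¹ = χ g := by
    intro g
    have := Representation.char_iso (Representation.Equiv.mk (ρ := τ) (σ := twistedDual τ 1) e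
      (fun g => LinearMap.ext fun v => twistedInvariant_iff.1 hB g v))
    have := congrFun this g
    rw [twistedDual, Representation.char_dual, hτ] at this
    rw [this, ← hτ]
    rfl
  have hR : RealValued χ := fun g => by rw [← hinv, hreal]
  have hα : ∀ g, τ.character ((1 : MulAut G) g) = τ.character g⁻¹ := fun g => by
    rw [hτ, hτ, hreal, MulAut.one_apply]
  have hnd : B.Nondegenerate := by
    refine LinearMap.BilinForm.nondegenerate_iff_ker_eq_bot.2 ?_
    exact LinearMap.ker_eq_bot.2 hinj
  obtain ⟨ε, hε, hflip⟩ := hB.flip_eq hs hα hB0 (one_pow 2)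
  have hflip' : ∀ v w, B w v = ε * B v w := fun v w => LinearMap.congr_fun₂ hflip v w
  have hinvt : InvariantForm τ B := fun g v w => hB g v w
  rcases hε with rfl | rfl
  · refine hO.1 ⟨hR, n, τ, hτ, B, ?_, hnd, hinvt⟩
    exact ⟨fun v w => by simpa using hflip' w v⟩
  · refine hO.2 ⟨hR, n, τ, hτ, B, fun v => ?_, hnd, hinvt⟩
    have := hflip' v v
    rw [neg_one_mul] at this
    exact self_eq_neg.1 this

/-- Conjugating `g` by `y` gives, up to conjugacy in `G`, the image of `g` under the `⟨α⟩`-component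
of `y`. The assumption `α ≠ 1` makes `⟨α⟩` have exactly two elements. -/
theorem inducedChar_inl (α : MulAut G) (hα : α ^ 2 = 1) (hα1 : α ≠ 1)
    (hclass : ∀ g h, χ (h * g * h⁻¹) = χ g) (g : G) :
    inducedChar χ α (SemidirectProduct.inl g) = χ g + χ (α g) := by
  classical
  have h0 : (Nat.card G : ℂ) ≠ 0 := Nat.cast_ne_zero.2 Nat.card_pos.ne'
  rw [inducedChar, inv_mul_eq_iff_eq_mul₀ h0]
  have hfin : Finite (Subgroup.zpowers α) := by
    have : IsOfFinOrder α := isOfFinOrder_iff_pow_eq_one.2 ⟨2, two_pos, hα⟩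
    exact this.finite_zpowers
  refine (finsum_congr (g := fun y : ExtGroup α => χ ((y.right : MulAut G) g)) fun y => ?_).trans ?_
  · have hr : (y * SemidirectProduct.inl g * y⁻¹).right = 1 := by simp
    rw [if_pos hr, ← hclass ((y.right : MulAut G) g) y.left]
    congr 1
    simp [SemidirectProduct.mul_left, SemidirectProduct.inv_left, mul_assoc]
  rw [← finsum_comp_equiv (SemidirectProduct.equivProd (φ := (Subgroup.zpowers α).subtype)).symm]
  let _ : Fintype (Subgroup.zpowers α) := Fintype.ofFinite _
  rw [finsum_eq_sum_of_fintype, Fintype.sum_prod_type]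
  have huniv : (Finset.univ : Finset (Subgroup.zpowers α)) =
      {1, ⟨α, Subgroup.mem_zpowers α⟩} := by
    symm
    refine Finset.eq_univ_iff_forall.2 fun ⟨β, hβ⟩ => ?_
    obtain ⟨k, rfl⟩ := Subgroup.mem_zpowers_iff.1 hβ
    rcases Int.even_or_odd' k with ⟨l, rfl | rfl⟩
    · simp [zpow_mul, hα]
    · simp [zpow_add, zpow_mul, hα]
  have hne : (1 : Subgroup.zpowers α) ≠ ⟨α, Subgroup.mem_zpowers α⟩ := by
    intro h
    exact hα1 (congrArg Subtype.val h).symm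
  have hinner : ∀ x : G, ∑ y : Subgroup.zpowers α,
      χ (((SemidirectProduct.equivProd (φ := (Subgroup.zpowers α).subtype)).symm
        (x, y)).right.1 g) = χ g + χ (α g) := by
    intro x
    rw [huniv, Finset.sum_pair hne]
    rfl
  simp only [hinner, Finset.sum_const, Finset.card_univ, nsmul_eq_mul, Nat.card_eq_fintype_card]

/-- If the induced character has indicator `+`, then the twisted Frobenius-Schur sum is `+|G|`. -/
theorem sum_twisted_of_indicatorPlus (hχ : IsIrrChar χ) (hzero : ∑ g, χ g * χ g = 0)
    (hinv : ∀ g, χ g⁻¹ = conj (χ g)) (α : MulAut G) (hα2 : α ^ 2 = 1)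
    (hχα : ∀ g, χ (α g) = conj (χ g)) (hplus : IndicatorPlus (inducedChar χ α)) :
    ∑ g, χ (g * α g) = Nat.card G := by
  obtain ⟨n, τ, hτ, hs⟩ := hχ.exists_rep
  have h0 : (Nat.card G : ℂ) ≠ 0 := Nat.cast_ne_zero.2 Nat.card_pos.ne'
  -- For `α = 1` the character would be real, and its norm `|G|` would equal `∑ χ² = 0`.
  have hα1 : α ≠ 1 := by
    rintro rfl
    refine h0 ?_
    rw [← hs, ← hzero]
    refine Finset.sum_congr rfl fun g => ?_
    rw [hτ, hτ, hinv, ← hχα]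
    simp
  have hαα : ∀ g, α (α g) = g := fun g => by
    have := congrArg (fun β : MulAut G => β g) hα2
    simpa [pow_two] using this
  have hclass : ∀ g h, χ (h * g * h⁻¹) = χ g := fun g h => by
    rw [← hτ, ← hτ, Representation.char_conj]
  obtain ⟨-, m, π, hπ, Q, hQs, hQn, hQi⟩ := hplus
  let πG : Representation ℂ G (Fin m → ℂ) := π.comp SemidirectProduct.inl
  have hπG : ∀ g, πG.character g = χ g + χ (α g) := fun g =>
    (hπ _).trans (inducedChar_inl α hα2 hα1 hclass g)
  let a : ExtGroup α := SemidirectProduct.inr ⟨α, Subgroup.mem_zpowers α⟩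
  have haa : a * a = 1 := by
    rw [← map_mul, ← map_one SemidirectProduct.inr]
    congr 1
    exact Subtype.ext (by simpa [pow_two] using hα2)
  have hconj : ∀ g : G, a * SemidirectProduct.inl (α g) = SemidirectProduct.inl g * a := by
    intro g
    have h := SemidirectProduct.inl_aut (φ := (Subgroup.zpowers α).subtype)
      ⟨α, Subgroup.mem_zpowers α⟩ (α g)
    have h' : (SemidirectProduct.inl g : ExtGroup α) = a * SemidirectProduct.inl (α g) * a⁻¹ := by
      rw [← map_inv, ← h]
      congr 1
      exact (hαα g).symm
    rw [h', inv_mul_cancel_right]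
  -- Moving the second argument of `Q` by the element `a` over `α` turns invariance into twisted
  -- invariance, and `a² = 1` keeps the form symmetric.
  let t := π a
  let B : LinearMap.BilinForm ℂ (Fin m → ℂ) := Q.compl₂ t
  have hBapp : ∀ v w, B v w = Q v (t w) := fun v w => rfl
  have hB : TwistedInvariant πG α B := by
    intro g v w
    rw [hBapp, hBapp]
    have : t (πG (α g) w) = πG g (t w) := by
      change (π a * π (SemidirectProduct.inl (α g))) w = (π (SemidirectProduct.inl g) * π a) w
      rw [← map_mul, ← map_mul, hconj]
    rw [this]
    exact hQi (SemidirectProduct.inl g) v (t w)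
  have hBs : ∀ v w, B v w = B w v := by
    intro v w
    rw [hBapp, hBapp, ← hQi a v (t w)]
    have : π a (t w) = w := by
      change (π a * π a) w = w
      rw [← map_mul, haa, map_one, Module.End.one_apply]
    rw [this]
    exact hQs.eq _ _
  have hBinj : ∀ v, (∀ w, B v w = 0) → v = 0 := by
    intro v hv
    refine hQn.1 v fun w => ?_
    have := hv (t w)
    rw [hBapp] at this
    have h2 : t (t w) = w := by
      change (π a * π a) w = w
      rw [← map_mul, haa, map_one, Module.End.one_apply]
    rwa [h2] at this
  -- The restriction to `G` has character `χ + conj χ` with orthogonal summands, so `τ` occurs in it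
  -- once.
  have hsum1 : ∑ g, πG.character g * τ.character g⁻¹ = Nat.card G := by
    simp only [hπG, hτ, add_mul, Finset.sum_add_distrib]
    have e1 : ∑ g, χ (α g) * χ g⁻¹ = 0 := by
      rw [← hzero]
      refine Fintype.sum_equiv (Equiv.inv G) _ _ fun g => ?_
      rw [Equiv.inv_apply, hχα, hinv]
    rw [e1, add_zero, ← hs]
    simp only [hτ]
  have hαc : ∀ g, τ.character (α g) = τ.character g⁻¹ := fun g => by
    rw [hτ, hτ, hχα, hinv]
  have hsum2 : ∑ g, (twistedDual τ α).character g * πG.character g⁻¹ = Nat.card G := by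
    simp only [twistedDual_character hαc]
    rw [← hsum1]
    refine Fintype.sum_equiv (Equiv.inv G) _ _ fun g => ?_
    rw [Equiv.inv_apply, inv_inv, mul_comm]
  obtain ⟨f, hf0, -⟩ := intertwining_line hsum1
  have hf0' : f.toLinearMap ≠ 0 := fun h => hf0 (Representation.IntertwiningMap.ext h)
  have hfint : ∀ g v, f.toLinearMap (τ g v) = πG g (f.toLinearMap v) :=
    fun g v => f.isIntertwining _ _ g v
  have hfinj : Function.Injective f.toLinearMap :=
    injective_of_intertwining hs hf0' fun g v hv => by rw [hfint, hv, map_zero]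
  let B0 : LinearMap.BilinForm ℂ (Fin n → ℂ) := B.compl₁₂ f.toLinearMap f.toLinearMap
  have hB0app : ∀ v w, B0 v w = B (f.toLinearMap v) (f.toLinearMap w) := fun v w => rfl
  have hB0inv : TwistedInvariant τ α B0 := by
    intro g v w
    rw [hB0app, hB0app, hfint, hfint, hB]
  -- Suppose `B` vanishes on the image of `f`. The map `p` pairing with that image is then a
  -- multiple of `q = B1 ∘ r`, where `r` is an averaged retraction with `r ∘ f = |G|`. As `p`
  -- vanishes on the image of `f` and `q` does not, `p = 0`, contradicting non-degeneracy of `B`.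
  have hB0ne : B0 ≠ 0 := by
    intro hB00
    obtain ⟨B1, hB1ne, hB1⟩ := exists_twistedInvariant hs hαc
    obtain ⟨r0, hr0⟩ := f.toLinearMap.exists_leftInverse_of_injective
      (LinearMap.ker_eq_bot.2 hfinj)
    let r : (Fin m → ℂ) →ₗ[ℂ] (Fin n → ℂ) := ∑ g, τ g ∘ₗ r0 ∘ₗ πG g⁻¹
    have hr : ∀ g v, r (πG g v) = τ g (r v) := by
      intro g v
      simp only [r, LinearMap.sum_apply, map_sum, LinearMap.comp_apply]
      refine Fintype.sum_equiv (Equiv.mulLeft g⁻¹) _ _ fun h => ?_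
      simp only [Equiv.coe_mulLeft, ← Module.End.mul_apply, ← map_mul, mul_inv_cancel_left,
        mul_inv_rev, inv_inv]
    have hrf : ∀ v, r (f.toLinearMap v) = (Nat.card G : ℂ) • v := by
      intro v
      simp only [r, LinearMap.sum_apply, LinearMap.comp_apply, ← hfint]
      have : ∀ g, τ g (r0 (f.toLinearMap (τ g⁻¹ v))) = v := by
        intro g
        have h1 : r0 (f.toLinearMap (τ g⁻¹ v)) = τ g⁻¹ v := LinearMap.congr_fun hr0 _
        rw [h1, ← Module.End.mul_apply, ← map_mul, mul_inv_cancel, map_one, Module.End.one_apply]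
      simp only [this, Finset.sum_const, Finset.card_univ, Nat.card_eq_fintype_card]
      rw [← Nat.cast_smul_eq_nsmul ℂ]
    let p : (Fin m → ℂ) →ₗ[ℂ] Module.Dual ℂ (Fin n → ℂ) := B.compl₂ f.toLinearMap
    have hpapp : ∀ w v, p w v = B w (f.toLinearMap v) := fun w v => rfl
    have hp : ∀ g w, p (πG g w) = twistedDual τ α g (p w) := by
      intro g w
      refine LinearMap.ext fun v => ?_
      rw [twistedDual_apply, hpapp, hpapp, ← hB g w, ← hfint, ← Module.End.mul_apply, ← map_mul,
        ← map_mul, mul_inv_cancel, map_one, map_one, Module.End.one_apply]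
    let q : (Fin m → ℂ) →ₗ[ℂ] Module.Dual ℂ (Fin n → ℂ) := B1 ∘ₗ r
    have hq : ∀ g w, q (πG g w) = twistedDual τ α g (q w) := by
      intro g w
      change B1 (r _) = _
      rw [hr, twistedInvariant_iff.1 hB1]
      rfl
    have hqf : ∀ v, q (f.toLinearMap v) = (Nat.card G : ℂ) • B1 v := by
      intro v
      change B1 (r _) = _
      rw [hrf, map_smul]
    have hq0 : q ≠ 0 := by
      intro h
      refine hB1ne (LinearMap.ext fun v => ?_)
      have h1 := hqf v
      rw [h, LinearMap.zero_apply, eq_comm, smul_eq_zero, or_iff_right h0] at h1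
      rw [h1, LinearMap.zero_apply]
    obtain ⟨c, hc⟩ := intertwining_unique hsum2 hq hq0 hp
    have hpf : ∀ v, p (f.toLinearMap v) = 0 := fun v => LinearMap.congr_fun hB00 v
    have hc0 : c = 0 := by
      by_contra hc0
      refine hB1ne (LinearMap.ext fun v => ?_)
      have h1 := hpf v
      rw [hc, LinearMap.smul_apply, hqf, smul_eq_zero, or_iff_right hc0, smul_eq_zero,
        or_iff_right h0] at h1
      rw [h1, LinearMap.zero_apply]
    rw [hc0, zero_smul] at hc
    refine hf0' (LinearMap.ext fun v => hBinj _ fun w => ?_)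
    rw [hBs, ← hpapp, hc]
    rfl
  have hflip : B0.flip = (1 : ℂ) • B0 := by
    rw [one_smul]
    exact LinearMap.ext₂ fun v w => hBs _ _
  have := hB0inv.sum_char hs hB0ne hflip
  simpa only [hτ, one_mul] using this

end Indicators

/-! ### Unramified quadratic algebras -/

section Quadratic

open NumberField IsDedekindDomain

/-- Criterion for vanishing differentials: a localization of `S` in which every element of `S` is,
up to a unit from `R`, a polynomial of degree one in an element `y` with `2 y` a unit and
`y ^ 2 ∈ R`. -/
theorem formallyUnramified_of_sqrt {R S T : Type*} [CommRing R] [CommRing S] [CommRing T]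
    [Algebra R S] [Algebra S T] [Algebra R T] [IsScalarTower R S T] (M : Submonoid S)
    [IsLocalization M T] (y : S) (r : R) (hy : y ^ 2 = algebraMap R S r)
    (h2y : IsUnit (algebraMap S T (2 * y)))
    (hS : ∀ x : S, ∃ t p q : R, IsUnit (algebraMap R T t) ∧
      algebraMap R S t * x = algebraMap R S p + algebraMap R S q * y) :
    Algebra.FormallyUnramified R T := by
  let D := KaehlerDifferential.D R T
  -- Differentiating `y² = r` gives `2y dy = 0`, and `2y` is a unit.
  have hDy : D (algebraMap S T y) = 0 := by
    have h1 : D (algebraMap S T y ^ 2) = 0 := by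
      rw [← map_pow, hy, ← IsScalarTower.algebraMap_apply, Derivation.map_algebraMap]
    rw [Derivation.leibniz_pow, Nat.add_one_sub_one, pow_one, ← Nat.cast_smul_eq_nsmul T,
      smul_smul] at h1
    refine (h2y.smul_eq_zero).1 ?_
    rw [map_mul, map_ofNat]
    exact h1
  have hDS : ∀ x : S, D (algebraMap S T x) = 0 := by
    intro x
    obtain ⟨t, p, q, ht, htx⟩ := hS x
    have h1 := congrArg (fun z => D (algebraMap S T z)) htx
    simp only [map_mul, map_add, ← IsScalarTower.algebraMap_apply, Derivation.leibniz,
      Derivation.map_algebraMap, smul_zero, add_zero, hDy] at h1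
    exact ht.smul_eq_zero.1 h1
  have hD : ∀ z : T, D z = 0 := by
    intro z
    obtain ⟨x, s, rfl⟩ := IsLocalization.exists_mk'_eq M z
    have h1 := congrArg D (IsLocalization.mk'_spec T x s)
    rw [Derivation.leibniz, hDS, hDS, smul_zero, zero_add] at h1
    exact (IsLocalization.map_units T s).smul_eq_zero.1 h1
  refine ⟨subsingleton_of_forall_eq 0 fun ω => ?_⟩
  have hω : ω ∈ Submodule.span T (Set.range D) := by
    rw [KaehlerDifferential.span_range_derivation]; exact Submodule.mem_top
  have : Set.range D ⊆ {0} := by rintro _ ⟨z, rfl⟩; exact hD z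
  simpa using Submodule.span_mono this hω

variable {K : Type*} [Field K] [NumberField K]

/-- Even valuation allows a square factor that makes `d` a unit at `v`; a denominator outside `v`,
squared as well, then makes it integral everywhere. -/
theorem exists_mul_sq_integral (v : HeightOneSpectrum (𝓞 K)) {d : K} (hd : d ≠ 0)
    (hv : IsSquare (v.valuation K d)) :
    ∃ (s : K) (d' : 𝓞 K), s ≠ 0 ∧ d' ∉ v.asIdeal ∧ d * s ^ 2 = algebraMap (𝓞 K) K d' := by
  obtain ⟨w, hw⟩ := hv
  have hw0 : w ≠ 0 := by
    rintro rfl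
    rw [mul_zero, map_eq_zero] at hw
    exact hd hw
  obtain ⟨t, ht⟩ := v.valuation_surjective K w⁻¹
  have ht0 : t ≠ 0 := by
    rintro rfl
    rw [map_zero, eq_comm, inv_eq_zero] at ht
    exact hw0 ht
  have h1 : v.valuation K (d * t ^ 2) = 1 := by
    rw [map_mul, map_pow, hw, ht]
    field_simp
  obtain ⟨a, b, hab⟩ := v.exists_primeCompl_mul_eq_of_integer (d * t ^ 2) h1.le
  have hb0 : (algebraMap (𝓞 K) K b) ≠ 0 := by
    intro h
    rw [map_eq_zero_iff _ (IsFractionRing.injective (𝓞 K) K)] at h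
    exact b.2 (h ▸ v.asIdeal.zero_mem)
  refine ⟨t * algebraMap (𝓞 K) K b, a * b, mul_ne_zero ht0 hb0, ?_, ?_⟩
  · rw [← v.valuation_eq_one_iff_notMem (K := K)]
    have hb := (v.valuation_eq_one_iff_notMem (K := K)).2 b.2
    rw [map_mul, ← hab, map_mul, map_mul, h1, hb]
    simp
  · rw [map_mul, ← hab]; ring

/-- After inverting `2d'`, which is prime to `v`, the integral closure is generated by `y = sθ` with
`y² = d'`. Nothing requires the algebra to be a field, so square `d` is included. -/
theorem not_ramifiesIn_of_isSquare_valuation (v : HeightOneSpectrum (𝓞 K)) {d : K} (hd : d ≠ 0)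
    (h2 : (2 : 𝓞 K) ∉ v.asIdeal) (hv : IsSquare (v.valuation K d)) :
    ¬ RamifiesIn v (quadAlgebra d) := by
  rw [RamifiesIn, not_not]
  intro 𝔓 _ hover
  obtain ⟨s, d', hs0, hd', hdd⟩ := exists_mul_sq_integral v hd hv
  have hmonic : (Polynomial.X ^ 2 - Polynomial.C d : K[X]).Monic :=
    Polynomial.monic_X_pow_sub_C d two_ne_zero
  have hdeg : (Polynomial.X ^ 2 - Polynomial.C d : K[X]).natDegree = 2 :=
    Polynomial.natDegree_X_pow_sub_C
  let θ : (quadAlgebra d) := AdjoinRoot.root _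
  have hθ : θ ^ 2 = algebraMap K (quadAlgebra d) d := by
    have := AdjoinRoot.eval₂_root (Polynomial.X ^ 2 - Polynomial.C d : K[X])
    simp only [Polynomial.eval₂_sub, Polynomial.eval₂_pow, Polynomial.eval₂_X,
      Polynomial.eval₂_C] at this
    exact sub_eq_zero.1 this
  have : Nontrivial (quadAlgebra d) := AdjoinRoot.nontrivial _ (by
    rw [Polynomial.degree_X_pow_sub_C two_pos]; simp)
  have hinj : Function.Injective (algebraMap K (quadAlgebra d)) := (algebraMap K (quadAlgebra d)).injective
  have hform : ∀ x : (quadAlgebra d), ∃ u w : K, x = algebraMap K (quadAlgebra d) u + algebraMap K (quadAlgebra d) w * θ := by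
    intro x
    obtain ⟨f, rfl⟩ := AdjoinRoot.mk_surjective x
    have hlt : (f %ₘ (Polynomial.X ^ 2 - Polynomial.C d)).natDegree ≤ 1 := by
      have := Polynomial.natDegree_modByMonic_lt f hmonic (by
        intro h; rw [h, Polynomial.natDegree_one] at hdeg; omega)
      omega
    obtain ⟨w, u, hwu⟩ := Polynomial.exists_eq_X_add_C_of_natDegree_le_one hlt
    refine ⟨u, w, ?_⟩
    rw [← AdjoinRoot.mk_leftInverse hmonic (AdjoinRoot.mk _ f), AdjoinRoot.modByMonicHom_mk, hwu,
      map_add, map_mul, add_comm]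
    rfl
  have hθint : IsIntegral (𝓞 K) (algebraMap K (quadAlgebra d) s * θ) := by
    refine IsIntegral.of_pow two_pos ?_
    rw [mul_pow, hθ, ← map_pow, ← map_mul, mul_comm, hdd, ← IsScalarTower.algebraMap_apply (𝓞 K) K (quadAlgebra d)]
    exact isIntegral_algebraMap
  let y : integralClosure (𝓞 K) (quadAlgebra d) := ⟨algebraMap K (quadAlgebra d) s * θ, hθint⟩
  have hy : y ^ 2 = algebraMap (𝓞 K) (integralClosure (𝓞 K) (quadAlgebra d)) d' := by
    refine Subtype.ext ?_
    change (algebraMap K (quadAlgebra d) s * θ) ^ 2 = algebraMap (𝓞 K) (quadAlgebra d) d'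
    rw [mul_pow, hθ, ← map_pow, ← map_mul, mul_comm, hdd, ← IsScalarTower.algebraMap_apply (𝓞 K) K (quadAlgebra d)]
  -- The conjugation `θ ↦ -θ`. For integral `x = u + wθ`, both `x + c x = 2u` and `y (x - c x) =
  -- 2wsd` are integral elements of `K`.
  let c : (quadAlgebra d) →ₐ[K] (quadAlgebra d) := AdjoinRoot.liftAlgHom _ (Algebra.ofId K (quadAlgebra d)) (-θ) (by
    simp only [Polynomial.eval₂_sub, Polynomial.eval₂_pow, Polynomial.eval₂_X,
      Polynomial.eval₂_C, neg_sq, hθ]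
    exact sub_self _)
  have hcθ : c θ = -θ := AdjoinRoot.liftAlgHom_root _ _ _ _
  have hmem : ∀ r : (𝓞 K), algebraMap (𝓞 K) (integralClosure (𝓞 K) (quadAlgebra d)) r ∈ 𝔓 ↔ r ∈ v.asIdeal := fun r => by
    rw [← Ideal.mem_comap, ← Ideal.under_def, ← Ideal.over_def 𝔓 v.asIdeal]
  have hunit : ∀ r : (𝓞 K), r ∉ v.asIdeal → IsUnit (algebraMap (𝓞 K) (Localization.AtPrime 𝔓) r) := by
    intro r hr
    rw [IsScalarTower.algebraMap_apply (𝓞 K) (integralClosure (𝓞 K) (quadAlgebra d))]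
    exact IsLocalization.map_units _ (⟨_, fun h => hr ((hmem r).1 h)⟩ : 𝔓.primeCompl)
  have h2d : 2 * d' ∉ v.asIdeal := fun h => (v.isPrime.mem_or_mem h).elim h2 hd'
  have hKint : ∀ k : K, IsIntegral (𝓞 K) (algebraMap K (quadAlgebra d) k) → ∃ r : (𝓞 K), algebraMap (𝓞 K) K r = k := by
    intro k hk
    exact IsIntegrallyClosed.isIntegral_iff.1 ((isIntegral_algebraMap_iff hinj).1 hk)
  refine formallyUnramified_of_sqrt 𝔓.primeCompl y d' hy ?_ ?_
  · have h1 : IsUnit (algebraMap (integralClosure (𝓞 K) (quadAlgebra d)) (Localization.AtPrime 𝔓) (y ^ 2)) := by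
      rw [hy, ← IsScalarTower.algebraMap_apply]
      exact hunit d' hd'
    rw [map_pow, isUnit_pow_iff two_ne_zero] at h1
    have h3 := hunit 2 h2
    rw [map_mul]
    refine IsUnit.mul ?_ h1
    rwa [map_ofNat] at h3 ⊢
  · intro x
    obtain ⟨u, w, hx⟩ := hform x
    have hcx : c x = algebraMap K (quadAlgebra d) u - algebraMap K (quadAlgebra d) w * θ := by
      rw [hx, map_add, map_mul, hcθ, AlgHom.commutes, AlgHom.commutes]; ring
    have hcint : IsIntegral (𝓞 K) (c x) := by
      have : IsIntegral (𝓞 K) (x : (quadAlgebra d)) := x.2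
      exact this.map c
    obtain ⟨p, hp⟩ := hKint (2 * u) (by
      have : algebraMap K (quadAlgebra d) (2 * u) = x + c x := by
        rw [hcx, hx, map_mul, map_ofNat]; ring
      rw [this]
      exact IsIntegral.add x.2 hcint)
    obtain ⟨q, hq⟩ := hKint (2 * w * s * d) (by
      have : algebraMap K (quadAlgebra d) (2 * w * s * d) = (y : (quadAlgebra d)) * (x - c x) := by
        rw [hcx, hx, map_mul, map_mul, map_mul, ← hθ, map_ofNat]
        change _ = (algebraMap K (quadAlgebra d) s * θ) * _
        ring
      rw [this]
      exact IsIntegral.mul hθint (IsIntegral.sub x.2 hcint))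
    -- From `d s² = d'`: `2d' x = d' (2u) + (2wsd)(sθ)`.
    refine ⟨2 * d', d' * p, q, hunit _ h2d, Subtype.ext ?_⟩
    change algebraMap (𝓞 K) (quadAlgebra d) (2 * d') * (x : (quadAlgebra d)) =
      algebraMap (𝓞 K) (quadAlgebra d) (d' * p) + algebraMap (𝓞 K) (quadAlgebra d) q * (algebraMap K (quadAlgebra d) s * θ)
    rw [IsScalarTower.algebraMap_apply (𝓞 K) K (quadAlgebra d), IsScalarTower.algebraMap_apply (𝓞 K) K (quadAlgebra d),
      IsScalarTower.algebraMap_apply (𝓞 K) K (quadAlgebra d), hq, hx]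
    simp only [map_mul, map_ofNat, hp, ← hdd, map_pow]
    ring

end Quadratic

/-! ### Stable lattices and the Gram determinant -/

section Lattice

open Matrix

theorem det_mem_subring {L : Type*} [CommRing L] (O : Subring L) {n : Type*} [Fintype n]
    [DecidableEq n] (M : Matrix n n L) (hM : ∀ i j, M i j ∈ O) : M.det ∈ O := by
  rw [Matrix.det_apply]
  refine sum_mem fun σ _ => ?_
  rw [Units.smul_def]
  exact zsmul_mem (prod_mem fun i _ => hM _ _) _

/-- A finite group acting on a finite-dimensional vector space over the fraction field of a
principal ideal domain stabilizes a free lattice. -/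
theorem exists_basis_integral {L : Type*} [Field L] (O : Subring L) [IsPrincipalIdealRing O]
    [IsFractionRing O L] {G V : Type*} [Group G] [Finite G] [AddCommGroup V] [Module L V]
    [FiniteDimensional L V] (ρ : Representation L G V) :
    ∃ b : Module.Basis (Fin (Module.finrank L V)) L V,
      ∀ g i j, LinearMap.toMatrix b b (ρ g) i j ∈ O := by
  let b₀ := Module.finBasis L V
  -- The translates of a basis span a stable lattice, which is free over a principal ideal domain.
  let s : Set V := Set.range fun x : G × Fin (Module.finrank L V) => ρ x.1 (b₀ x.2)
  let M : Submodule O V := Submodule.span O s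
  have hM : Submodule.IsLattice L M := by
    refine ⟨Submodule.fg_span (Set.finite_range _), eq_top_iff.2 ?_⟩
    rw [← b₀.span_eq]
    refine Submodule.span_mono ?_
    rintro _ ⟨i, rfl⟩
    exact Submodule.subset_span ⟨(1, i), by simp⟩
  have hstab : ∀ g, ∀ x ∈ M, ρ g x ∈ M := by
    intro g x hx
    induction hx using Submodule.span_induction with
    | zero => simp
    | add a b _ _ ha hb => rw [map_add]; exact add_mem ha hb
    | smul c a _ ha =>
      have : ρ g (c • a) = c • ρ g a := (ρ g).map_smul (c : L) a
      rw [this]; exact M.smul_mem _ ha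
    | mem a ha =>
      obtain ⟨⟨h, i⟩, rfl⟩ := ha
      exact Submodule.subset_span ⟨(g * h, i), by simp⟩
  let bO := Module.Free.chooseBasis O M
  let b₁ := bO.extendOfIsLattice L
  have hrepr : ∀ (x : M) i, b₁.repr (x : V) i = (bO.repr x i : L) := by
    intro x i
    have hx : (x : V) = ∑ j, (bO.repr x j : L) • b₁ j := by
      conv_lhs => rw [← bO.sum_repr x]
      rw [Submodule.coe_sum]
      refine Finset.sum_congr rfl fun j _ => ?_
      rw [Module.Basis.extendOfIsLattice_apply]
      rfl
    rw [hx, b₁.repr_sum_self]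
  have hcard : Fintype.card (Module.Free.ChooseBasisIndex O M) = Module.finrank L V :=
    (Module.finrank_eq_card_basis b₁).symm
  refine ⟨b₁.reindex (Fintype.equivFinOfCardEq hcard), fun g i j => ?_⟩
  rw [LinearMap.toMatrix_apply, Module.Basis.repr_reindex_apply, Module.Basis.reindex_apply,
    Module.Basis.extendOfIsLattice_apply]
  rw [hrepr ⟨_, hstab g _ (bO _).2⟩]
  exact Subtype.property _

/-- As `|G|` is a unit, Fourier inversion writes every integral matrix as an integral combination of
the `ρ g` on a stable lattice. The adjoint of `B` permutes the `ρ g`, so `S⁻¹ Xᵀ S` is integral for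
all integral `X`. This makes `S` a scalar times an invertible integral matrix, and the scalar
contributes an even power to the determinant. -/
theorem isSquare_valuation_det_twisted {L : Type*} [Field L] [CharZero L] {Γ₀ : Type*}
    [LinearOrderedCommGroupWithZero Γ₀] (val : Valuation L Γ₀)
    [IsPrincipalIdealRing val.valuationSubring]
    {G V : Type*} [Group G] [Fintype G] [AddCommGroup V] [Module L V]
    [FiniteDimensional L V] {ρ : Representation L G V}
    (hs : ∑ g, ρ.character g * ρ.character g⁻¹ = (Nat.card G : L))
    (hval : val (Nat.card G : L) = 1) {α : MulAut G} {B : LinearMap.BilinForm L V}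
    (hB : TwistedInvariant ρ α B) (hB0 : B ≠ 0) (heven : Even (Module.finrank L V)) :
    ∃ b : Module.Basis (Fin (Module.finrank L V)) L V,
      IsSquare (val (LinearMap.BilinForm.toMatrix b B).det) := by
  let O := val.valuationSubring
  have hO : ∀ x, x ∈ O ↔ val x ≤ 1 := fun x => Valuation.mem_valuationSubring_iff _ _
  have : IsPrincipalIdealRing O.toSubring := ‹IsPrincipalIdealRing val.valuationSubring›
  have : IsFractionRing O.toSubring L := inferInstanceAs (IsFractionRing O L)
  obtain ⟨b, hb⟩ := exists_basis_integral O.toSubring ρ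
  refine ⟨b, ?_⟩
  set S := LinearMap.BilinForm.toMatrix b B with hSdef
  have hS0 : S ≠ 0 := by
    rw [hSdef, Ne, LinearEquiv.map_eq_zero_iff]
    exact hB0
  have hnd : B.Nondegenerate :=
    LinearMap.BilinForm.nondegenerate_iff_ker_eq_bot.2
      (LinearMap.ker_eq_bot.2 (hB.injective hs hB0))
  have hdet : S.det ≠ 0 := (LinearMap.BilinForm.nondegenerate_iff_det_ne_zero b).1 hnd
  have hadj : ∀ g v w, B (ρ g v) w = B v (ρ (α g⁻¹) w) := by
    intro g v w
    rw [← hB g v (ρ (α g⁻¹) w), ← Module.End.mul_apply, ← map_mul, ← map_mul, mul_inv_cancel,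
      map_one, map_one, Module.End.one_apply]
  have hadjm : ∀ g, (LinearMap.toMatrix b b (ρ g))ᵀ * S =
      S * LinearMap.toMatrix b b (ρ (α g⁻¹)) := by
    intro g
    rw [hSdef, ← LinearMap.BilinForm.toMatrix_compLeft, ← LinearMap.BilinForm.toMatrix_compRight]
    congr 1
    exact LinearMap.ext₂ fun v w => hadj g v w
  have hcoef : ((Module.finrank L V) * (Nat.card G : L)⁻¹) ∈ O := by
    rw [hO, map_mul, map_inv₀, hval, inv_one, mul_one, ← hO]
    exact natCast_mem O (Module.finrank L V)
  have hint : ∀ X : Matrix (Fin (Module.finrank L V)) (Fin (Module.finrank L V)) L,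
      (∀ i j, X i j ∈ O) → ∀ k l, (S⁻¹ * Xᵀ * S) k l ∈ O := by
    intro X hX k l
    have hinv := congrArg (LinearMap.toMatrix b b) (fourier_inversion hs (Matrix.toLin b b X))
    rw [LinearMap.toMatrix_toLin, map_smul, map_sum] at hinv
    simp only [map_smul] at hinv
    have htr : ∀ g, LinearMap.trace L V (Matrix.toLin b b X * ρ g⁻¹) ∈ O := by
      intro g
      rw [LinearMap.trace_eq_matrix_trace L b, LinearMap.toMatrix_mul, LinearMap.toMatrix_toLin]
      refine sum_mem fun i _ => ?_
      rw [Matrix.diag_apply, Matrix.mul_apply]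
      exact sum_mem fun j _ => mul_mem (hX _ _) (hb _ _ _)
    have hres : S⁻¹ * Xᵀ * S = ((Module.finrank L V) * (Nat.card G : L)⁻¹) •
        ∑ g, LinearMap.trace L V (Matrix.toLin b b X * ρ g⁻¹) •
          LinearMap.toMatrix b b (ρ (α g⁻¹)) := by
      rw [hinv, Matrix.transpose_smul, Matrix.transpose_sum, Matrix.mul_assoc, Matrix.smul_mul,
        Matrix.mul_smul, Matrix.sum_mul, Matrix.mul_sum, ← hinv]
      congr 1
      refine Finset.sum_congr rfl fun g _ => ?_
      rw [Matrix.transpose_smul, Matrix.smul_mul, Matrix.mul_smul, hadjm,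
        Matrix.nonsing_inv_mul_cancel_left _ _ hdet.isUnit]
    rw [hres, Matrix.smul_apply, Matrix.sum_apply]
    refine mul_mem hcoef (sum_mem fun g _ => ?_)
    exact mul_mem (htr g) (hb _ _ _)
  -- Matrix units for `X` isolate the products of entries.
  have hprod : ∀ i j k l, S⁻¹ k j * S i l ∈ O := by
    intro i j k l
    have h := hint (Matrix.single i j 1) (fun a c => by
      rw [Matrix.single_apply]
      split_ifs
      · exact one_mem O
      · exact zero_mem O) k l
    rwa [Matrix.transpose_single, Matrix.mul_assoc, Matrix.mul_apply, Finset.sum_eq_single j,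
      Matrix.single_mul_apply_same, one_mul] at h
    · intro a _ ha
      rw [Matrix.single_mul_apply_of_ne _ _ _ _ _ ha, mul_zero]
    · simp
  obtain ⟨i₁, j₁, hij₁⟩ : ∃ i j, S i j ≠ 0 := by
    by_contra! h
    exact hS0 (by ext i j; simp [h])
  have : Nonempty (Fin (Module.finrank L V) × Fin (Module.finrank L V)) := ⟨(i₁, j₁)⟩
  obtain ⟨⟨i₀, j₀⟩, hmax⟩ := Finite.exists_max
    fun x : Fin (Module.finrank L V) × Fin (Module.finrank L V) => val (S x.1 x.2)
  -- An entry of largest value: `c⁻¹ S` is integral by maximality and `c S⁻¹` by `hprod`. Their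
  -- determinants bound `val S.det` from both sides.
  set c := S i₀ j₀
  have hc0 : c ≠ 0 := by
    intro h
    have := hmax (i₁, j₁)
    rw [h, map_zero, le_zero_iff, map_eq_zero] at this
    exact hij₁ this
  have h1 : (c⁻¹ • S).det ∈ O.toSubring := by
    refine det_mem_subring _ _ fun i j => ?_
    change _ ∈ O
    rw [hO, Matrix.smul_apply, smul_eq_mul, map_mul, map_inv₀]
    exact inv_mul_le_one_of_le₀ (hmax (i, j)) zero_le
  have h2 : (c • S⁻¹).det ∈ O.toSubring := by
    refine det_mem_subring _ _ fun i j => ?_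
    rw [Matrix.smul_apply, smul_eq_mul, mul_comm]
    exact hprod _ _ _ _
  have hdc : val S.det = val c ^ (Module.finrank L V) := by
    have h1' : val (c⁻¹ • S).det ≤ 1 := (hO _).1 h1
    have h2' : val (c • S⁻¹).det ≤ 1 := (hO _).1 h2
    have hvc : val c ≠ 0 := (Valuation.ne_zero_iff _).2 hc0
    have hvS : val S.det ≠ 0 := (Valuation.ne_zero_iff _).2 hdet
    rw [Matrix.det_smul, Fintype.card_fin, map_mul, map_pow, map_inv₀, inv_pow] at h1'
    rw [Matrix.det_smul, Fintype.card_fin, map_mul, map_pow, Matrix.det_nonsing_inv,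
      Ring.inverse_eq_inv', map_inv₀] at h2'
    refine le_antisymm ?_ ?_
    · exact (inv_mul_le_one₀ (pow_pos (zero_lt_iff.2 hvc) (Module.finrank L V))).1 h1'
    · exact (mul_inv_le_iff₀ (zero_lt_iff.2 hvS)).1 h2' |>.trans_eq (one_mul _)
  rw [hdc]
  exact heven.isSquare_pow _

end Lattice

/-! ### Ramification in the character field -/

section Cyclotomic

open NumberField IsDedekindDomain

/-- Subextensions of the `N`-th cyclotomic field are unramified at primes not dividing `N`. -/
theorem exists_prime_over_unramified {K L E : Type*} [Field K] [NumberField K] [Field L]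
    [NumberField L] [Field E] [NumberField E] [Algebra K L] {N : ℕ} [NeZero N]
    [IsCyclotomicExtension {N} ℚ E] (ι : L →+* E)
    (v : HeightOneSpectrum (𝓞 K)) (hN : (N : 𝓞 K) ∉ v.asIdeal) :
    ∃ w : HeightOneSpectrum (𝓞 L), (N : 𝓞 L) ∉ w.asIdeal ∧
      ∀ x : K, w.valuation L (algebraMap K L x) = v.valuation K x := by
  let _ : Algebra L E := ι.toAlgebra
  let _ : Algebra K E := (ι.comp (algebraMap K L)).toAlgebra
  have : IsScalarTower K L E := IsScalarTower.of_algebraMap_eq fun _ => rfl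
  obtain ⟨⟨𝔓, _, _⟩⟩ := v.asIdeal.nonempty_primesOver (S := 𝓞 E)
  let w₀ := 𝔓.under (𝓞 L)
  have : w₀.LiesOver v.asIdeal := inferInstance
  have hw0 : w₀ ≠ ⊥ := Ideal.ne_bot_of_liesOver_of_ne_bot v.ne_bot _
  let w : HeightOneSpectrum (𝓞 L) := ⟨w₀, inferInstance, hw0⟩
  have : w.asIdeal.LiesOver v.asIdeal := ‹w₀.LiesOver v.asIdeal›
  let p := Ideal.absNorm (v.asIdeal.under ℤ)
  have hpv : v.asIdeal.LiesOver (Ideal.span {(p : ℤ)}) := Int.liesOver_span_absNorm _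
  have : NeZero v.asIdeal := ⟨v.ne_bot⟩
  have : Fact p.Prime := ⟨Nat.absNorm_under_prime v.asIdeal⟩
  have hpN : ¬ p ∣ N := by
    intro h
    refine hN ?_
    have := (Int.cast_mem_ideal_iff (I := v.asIdeal) (d := (N : ℤ))).2 (Int.natCast_dvd_natCast.2 h)
    simpa using this
  have hp0 : Ideal.span {(p : ℤ)} ≠ ⊥ := by
    rw [Ne, Ideal.span_singleton_eq_bot]
    exact_mod_cast (Fact.out : p.Prime).ne_zero
  have : 𝔓.LiesOver (Ideal.span {(p : ℤ)}) := Ideal.LiesOver.trans 𝔓 v.asIdeal _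
  -- The index is multiplicative along the tower from `ℤ` through `𝓞 K` and `𝓞 L` to `𝓞 E`, so the
  -- index of `w` over `v` is 1 too.
  have he : Ideal.ramificationIdx' (Ideal.span {(p : ℤ)}) 𝔓 = 1 := by
    rw [Ideal.ramificationIdx'_eq_ramificationIdx _ _ hp0]
    exact IsCyclotomicExtension.Rat.ramificationIdx_eq_of_not_dvd p E 𝔓 hpN
  rw [Ideal.ramificationIdx'_algebra_tower' _ v.asIdeal 𝔓] at he
  have he2 := Nat.eq_one_of_mul_eq_one_left he
  rw [Ideal.ramificationIdx'_algebra_tower' _ w.asIdeal 𝔓] at he2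
  have he3 := Nat.eq_one_of_mul_eq_one_right he2
  refine ⟨w, fun h => hN ?_, fun x => ?_⟩
  · rw [Ideal.over_def w.asIdeal v.asIdeal, Ideal.under_def, Ideal.mem_comap, map_natCast]
    exact h
  · rw [← v.valuation_liesOver L w x, he3, pow_one]

theorem isCyclotomicExtension_adjoin_simple {N : ℕ} [NeZero N] {ζ : ℂ}
    (hζ : IsPrimitiveRoot ζ N) :
    IsCyclotomicExtension {N} ℚ (IntermediateField.adjoin ℚ {ζ}) := by
  change IsCyclotomicExtension {N} ℚ (IntermediateField.adjoin ℚ {ζ}).toSubalgebra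
  rw [IntermediateField.adjoin_simple_toSubalgebra_of_isAlgebraic
    (hζ.isIntegral (NeZero.pos N)).tower_top.isAlgebraic]
  exact hζ.adjoin_isCyclotomicExtension ℚ

theorem NeZero.natCard {G : Type*} [Nonempty G] [Finite G] : NeZero (Nat.card G) :=
  ⟨Nat.card_pos.ne'⟩

/-- The character values of a finite group lie in the cyclotomic field of `|G|`-th roots of
unity. -/
theorem charField_le_cyclotomic {G : Type*} [Group G] [Finite G] {χ : G → ℂ} {n : ℕ}
    {τ : Representation ℂ G (Fin n → ℂ)} (hτ : Affords χ τ) {ζ : ℂ}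
    (hζ : IsPrimitiveRoot ζ (Nat.card G)) :
    charField χ ≤ IntermediateField.adjoin ℚ {ζ} := by
  have : NeZero (Nat.card G) := NeZero.natCard
  refine IntermediateField.adjoin_le_iff.2 ?_
  rintro _ ⟨g, rfl⟩
  -- A character value is a sum of eigenvalues, each a `|G|`-th root of unity.
  have htr : χ g = (LinearMap.toMatrix' (τ g)).charpoly.roots.sum := by
    rw [← hτ g, ← Matrix.trace_eq_sum_roots_charpoly, Representation.character,
      LinearMap.trace_eq_matrix_trace ℂ (Pi.basisFun ℂ (Fin n))]
    rfl
  rw [htr]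
  refine multiset_sum_mem _ fun μ hμ => ?_
  have hroot : (τ g).charpoly.IsRoot μ := by
    rw [← LinearMap.charpoly_toMatrix (τ g) (Pi.basisFun ℂ (Fin n))]
    exact Polynomial.isRoot_of_mem_roots hμ
  obtain ⟨x, hx⟩ := ((Module.End.hasEigenvalue_iff_isRoot_charpoly _ _).2 hroot).exists_hasEigenvector
  have hpow : μ ^ Nat.card G = 1 := by
    have h1 := hx.pow_apply (Nat.card G)
    rw [← map_pow, pow_card_eq_one', map_one, Module.End.one_apply] at h1
    have h2 : (μ ^ Nat.card G - 1) • x = 0 := by rw [sub_smul, one_smul, ← h1, sub_self]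
    exact sub_eq_zero.1 ((smul_eq_zero.1 h2).resolve_right hx.2)
  obtain ⟨i, -, rfl⟩ := hζ.eq_pow_of_pow_eq_one hpow
  exact pow_mem (IntermediateField.mem_adjoin_simple_self ℚ ζ) i

theorem numberField_charField {G : Type*} [Group G] [Finite G] {χ : G → ℂ} (hχ : IsIrrChar χ) :
    NumberField (charField χ) := by
  obtain ⟨n, τ, -, hτ⟩ := hχ
  have hζ := Complex.isPrimitiveRoot_exp (Nat.card G) Nat.card_pos.ne'
  have hle := charField_le_cyclotomic hτ hζ
  have : FiniteDimensional ℚ (IntermediateField.adjoin ℚ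
      {Complex.exp (2 * Real.pi * Complex.I / Nat.card G)}) :=
    IntermediateField.adjoin.finiteDimensional (hζ.isIntegral Nat.card_pos).tower_top
  have := FiniteDimensional.of_injective
    (IntermediateField.inclusion hle).toLinearMap (IntermediateField.inclusion_injective hle)
  exact { to_finiteDimensional := this }

/-- For a prime of the real subfield not dividing `|G|`, there is an unramified prime of the
character field above it. -/
theorem exists_prime_over_charField {G : Type*} [Group G] [Finite G] {χ : G → ℂ}
    (hχ : IsIrrChar χ) [NumberField (charField χ)] [NumberField (realField χ)]
    (v : HeightOneSpectrum (𝓞 (realField χ))) (hN : (Nat.card G : 𝓞 (realField χ)) ∉ v.asIdeal) :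
    ∃ w : HeightOneSpectrum (𝓞 (charField χ)), (Nat.card G : 𝓞 (charField χ)) ∉ w.asIdeal ∧
      ∀ x : realField χ, w.valuation (charField χ) (x : charField χ) =
        v.valuation (realField χ) x := by
  obtain ⟨n, τ, -, hτ⟩ := hχ
  have hζ := Complex.isPrimitiveRoot_exp (Nat.card G) Nat.card_pos.ne'
  have hle := charField_le_cyclotomic hτ hζ
  have : NeZero (Nat.card G) := NeZero.natCard
  let E := IntermediateField.adjoin ℚ {Complex.exp (2 * Real.pi * Complex.I / Nat.card G)}
  have : FiniteDimensional ℚ E :=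
    IntermediateField.adjoin.finiteDimensional (hζ.isIntegral Nat.card_pos).tower_top
  have : NumberField E := { to_finiteDimensional := this }
  have : IsCyclotomicExtension {Nat.card G} ℚ E :=
    isCyclotomicExtension_adjoin_simple hζ
  exact exists_prime_over_unramified (IntermediateField.inclusion hle).toRingHom v hN

end Cyclotomic

/-! ### The decomposition of `End_L(V)` over the fixed algebra -/

section FixedAlgebra

variable {L : Type} [Field L] [CharZero L] {G V : Type*} [Group G] [Fintype G] [AddCommGroup V]
  [Module L V] [FiniteDimensional L V]

/-- The field `L` is a quadratic extension of its subfield `K` with conjugation `c` and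
`L = K + δ K`, and `ρ` is an absolutely irreducible representation over `L` whose twist by the
involution `α` has the conjugate character; moreover `δ (ρ(g) - ρ(α(g)))` lies in the fixed
algebra. -/
structure ConjugateTwist (K : Subfield L) (c : L →+* L) (δ : L) (ρ : Representation L G V)
    (α : MulAut G) : Prop where
  mem_iff : ∀ x, x ∈ K ↔ c x = x
  invol : ∀ x, c (c x) = x
  conj_delta : c δ = -δ
  delta_ne_zero : δ ≠ 0
  sum_char : ∑ g, ρ.character g * ρ.character g⁻¹ = (Nat.card G : L)
  sq_eq_one : α ^ 2 = 1
  char_twist : ∀ g, ρ.character (α g) = ρ.character g⁻¹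
  conj_char : ∀ g, c (ρ.character g) = ρ.character (α g)
  delta_smul_mem : ∀ g, δ • (ρ g - ρ (α g)) ∈ fixedSpan K ρ α

/-- Summing the conjugates of `g₀` gives a scalar proportional to its character value, so the factor
on the left comes from the group ring. Then `(x - αx)(y - αy) = (xy + α(xy)) - (x αy + α(x αy))`
lies in the fixed span. This supplies `delta_smul_mem`. -/
theorem smul_sub_mem_fixedSpan {K : Subfield L} {ρ : Representation L G V} {α : MulAut G}
    (hs : ∑ g, ρ.character g * ρ.character g⁻¹ = (Nat.card G : L)) (hα2 : α ^ 2 = 1) (g₀ g : G) :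
    (ρ.character g₀ - ρ.character (α g₀)) • (ρ g - ρ (α g)) ∈ fixedSpan K ρ α := by
  have h0 : (Nat.card G : L) ≠ 0 := Nat.cast_ne_zero.2 Nat.card_pos.ne'
  have hn := finrank_cast_ne_zero hs
  have hαα : ∀ g, α (α g) = g := fun g => by
    have := congrArg (fun β : MulAut G => β g) hα2
    simpa [pow_two] using this
  let k : K := (Module.finrank L V : K) * (Nat.card G : K)⁻¹
  have hz : ∀ g₁ : G, ∑ h, ρ (h * g₁ * h⁻¹) =
      (Nat.card G * (Module.finrank L V : L)⁻¹ * ρ.character g₁) • 1 := by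
    intro g₁
    rw [Representation.character, ← sum_conj_eq hs (ρ g₁)]
    simp only [map_mul]
  have hz2 : ∑ h, ρ (h * α g₀ * h⁻¹) = ∑ h, ρ (α (h * g₀ * h⁻¹)) := by
    refine Fintype.sum_equiv α.toEquiv.symm _ _ fun h => ?_
    have : α (α.symm h) = h := α.apply_symm_apply h
    change _ = ρ (α (α.symm h * g₀ * (α.symm h)⁻¹))
    rw [map_mul α, map_mul α, map_inv α, this]
  have key : (ρ.character g₀ - ρ.character (α g₀)) • (ρ g - ρ (α g)) =
      k • ∑ h, ((ρ (h * g₀ * h⁻¹ * g) + ρ (α (h * g₀ * h⁻¹ * g))) -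
        (ρ (h * g₀ * h⁻¹ * α g) + ρ (α (h * g₀ * h⁻¹ * α g)))) := by
    have h1 : ∑ h, ((ρ (h * g₀ * h⁻¹ * g) + ρ (α (h * g₀ * h⁻¹ * g))) -
        (ρ (h * g₀ * h⁻¹ * α g) + ρ (α (h * g₀ * h⁻¹ * α g)))) =
        (∑ h, ρ (h * g₀ * h⁻¹) - ∑ h, ρ (h * α g₀ * h⁻¹)) * (ρ g - ρ (α g)) := by
      rw [hz2, ← Finset.sum_sub_distrib, Finset.sum_mul]
      refine Finset.sum_congr rfl fun h _ => ?_
      simp only [map_mul ρ _ g, map_mul ρ _ (α g), map_mul α _ g, map_mul α _ (α g), hαα]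
      noncomm_ring
    have hk : (k : L) = Module.finrank L V * (Nat.card G : L)⁻¹ := by simp [k]
    rw [h1, hz, hz, ← sub_smul, smul_mul_assoc, one_mul, Subfield.smul_def, smul_smul, hk]
    congr 1
    field_simp
  rw [key]
  refine Submodule.smul_mem _ _ (Submodule.sum_mem _ fun h _ => Submodule.sub_mem _ ?_ ?_)
  · exact Submodule.subset_span ⟨_, rfl⟩
  · exact Submodule.subset_span ⟨_, rfl⟩

namespace ConjugateTwist

variable {K : Subfield L} {c : L →+* L} {δ : L} {ρ : Representation L G V} {α : MulAut G}
  (D : ConjugateTwist K c δ ρ α)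
include D

theorem apply_apply (g : G) : α (α g) = g := by
  have := congrArg (fun β : MulAut G => β g) D.sq_eq_one
  simpa [pow_two] using this

theorem delta_sq_mem : δ ^ 2 ∈ K := by
  rw [D.mem_iff, map_pow, D.conj_delta, neg_sq]

theorem exists_eq_add_delta_mul (x : L) : ∃ a b : K, x = a + δ * b := by
  have h2 : (2 : L) ≠ 0 := two_ne_zero
  refine ⟨⟨(x + c x) / 2, ?_⟩, ⟨(x - c x) / (2 * δ), ?_⟩, ?_⟩
  · rw [D.mem_iff, map_div₀, map_add, D.invol, map_ofNat, add_comm]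
  · rw [D.mem_iff, map_div₀, map_sub, D.invol, map_mul, map_ofNat, D.conj_delta, mul_neg, div_neg,
      ← neg_div, neg_sub]
  · have := D.delta_ne_zero
    field_simp
    ring

theorem eq_zero_of_mem_of_mem {x y : L} (hx : x ∈ K) (hy : y ∈ K) (h : x = δ * y) : x = 0 := by
  have h1 := congrArg c h
  rw [map_mul, (D.mem_iff x).1 hx, (D.mem_iff y).1 hy, D.conj_delta, neg_mul, ← h] at h1
  exact self_eq_neg.1 h1

/-- The `ρ g` span over `L`. Each is half of `ρ g + ρ (α g)` plus half of `ρ g - ρ (α g)`, and the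
latter is `δ` times an element of the fixed span because `δ² ∈ K`. -/
theorem exists_decomp (x : Module.End L V) :
    ∃ a ∈ fixedSpan K ρ α, ∃ b ∈ fixedSpan K ρ α, x = a + δ • b := by
  have hx : x ∈ Submodule.span L (Set.range ρ) :=
    span_range_eq_top D.sum_char ▸ Submodule.mem_top
  induction hx using Submodule.span_induction with
  | zero => exact ⟨0, zero_mem _, 0, zero_mem _, by simp⟩
  | add x y _ _ hx hy =>
    obtain ⟨a, ha, b, hb, rfl⟩ := hx
    obtain ⟨a', ha', b', hb', rfl⟩ := hy
    exact ⟨_, add_mem ha ha', _, add_mem hb hb', by rw [smul_add]; abel⟩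
  | smul l x _ hx =>
    obtain ⟨a, ha, b, hb, rfl⟩ := hx
    obtain ⟨k₁, k₂, rfl⟩ := D.exists_eq_add_delta_mul l
    let e : K := ⟨δ ^ 2, D.delta_sq_mem⟩
    refine ⟨k₁ • a + (e * k₂) • b, add_mem (Submodule.smul_mem _ _ ha) (Submodule.smul_mem _ _ hb),
      k₁ • b + k₂ • a, add_mem (Submodule.smul_mem _ _ hb) (Submodule.smul_mem _ _ ha), ?_⟩
    simp only [Subfield.smul_def, Subfield.coe_mul, e]
    module
  | mem x hx =>
    obtain ⟨g, rfl⟩ := hx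
    let e : K := ⟨δ ^ 2, D.delta_sq_mem⟩
    refine ⟨(2 : K)⁻¹ • (ρ g + ρ (α g)), Submodule.smul_mem _ _ (Submodule.subset_span ⟨g, rfl⟩),
      ((2 : K)⁻¹ * e⁻¹) • (δ • (ρ g - ρ (α g))), Submodule.smul_mem _ _ (D.delta_smul_mem g), ?_⟩
    have hc : (((2 : K)⁻¹ : K) : L) = (2 : L)⁻¹ :=
      (map_inv₀ K.subtype 2).trans (by rw [map_ofNat])
    have hδ := D.delta_ne_zero
    have he' : (((2 : K)⁻¹ * e⁻¹ : K) : L) * δ * δ = (2 : L)⁻¹ := by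
      rw [Subfield.coe_mul, hc, Subfield.coe_inv, mul_assoc, mul_assoc, ← pow_two,
        inv_mul_cancel₀ (pow_ne_zero 2 hδ), mul_one]
    rw [smul_comm δ, Subfield.smul_def, Subfield.smul_def, smul_smul, smul_smul]
    rw [he', hc, ← smul_add, add_add_sub_cancel, ← two_smul L, smul_smul,
      inv_mul_cancel₀ two_ne_zero, one_smul]

theorem trace_mem {a : Module.End L V} (ha : a ∈ fixedSpan K ρ α) :
    LinearMap.trace L V a ∈ K := by
  induction ha using Submodule.span_induction with
  | zero => rw [map_zero]; exact zero_mem _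
  | add a b _ _ ha hb => rw [map_add]; exact add_mem ha hb
  | smul k a _ ha =>
    rw [Subfield.smul_def, map_smul]
    exact mul_mem k.2 ha
  | mem a ha =>
    obtain ⟨g, rfl⟩ := ha
    rw [map_add, D.mem_iff, map_add]
    change c (ρ.character g) + c (ρ.character (α g)) = ρ.character g + ρ.character (α g)
    rw [D.conj_char, D.conj_char, D.apply_apply, add_comm]

/-- Traces on the fixed span lie in `K`, so those of `a a'` lie in `K ∩ δK = 0`. Hence `a` is
trace-orthogonal to all endomorphisms and vanishes by Fourier inversion. -/
theorem eq_zero_of_eq_delta_smul {a b : Module.End L V} (ha : a ∈ fixedSpan K ρ α)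
    (hb : b ∈ fixedSpan K ρ α) (h : a = δ • b) : a = 0 := by
  have h1 : ∀ a' ∈ fixedSpan K ρ α, LinearMap.trace L V (a * a') = 0 := by
    intro a' ha'
    refine D.eq_zero_of_mem_of_mem (D.trace_mem (mul_mem_fixedSpan K ρ α D.sq_eq_one ha ha'))
      (D.trace_mem (mul_mem_fixedSpan K ρ α D.sq_eq_one hb ha')) ?_
    rw [h, smul_mul_assoc, map_smul, smul_eq_mul]
  have h2 : ∀ x, LinearMap.trace L V (a * x) = 0 := by
    intro x
    obtain ⟨p, hp, q, hq, rfl⟩ := D.exists_decomp x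
    rw [mul_add, map_add, mul_smul_comm, map_smul, h1 p hp, h1 q hq, smul_zero, add_zero]
  rw [fourier_inversion D.sum_char a]
  simp [h2]

theorem decomp_unique {a b a' b' : Module.End L V} (ha : a ∈ fixedSpan K ρ α)
    (hb : b ∈ fixedSpan K ρ α) (ha' : a' ∈ fixedSpan K ρ α) (hb' : b' ∈ fixedSpan K ρ α)
    (h : a + δ • b = a' + δ • b') : a = a' ∧ b = b' := by
  have h1 : a - a' = δ • (b' - b) := by
    rw [smul_sub, sub_eq_sub_iff_add_eq_add, h, add_comm]
  have h2 := D.eq_zero_of_eq_delta_smul (sub_mem ha ha') (sub_mem hb' hb) h1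
  rw [h2, eq_comm, smul_eq_zero, or_iff_right D.delta_ne_zero] at h1
  exact ⟨sub_eq_zero.1 h2, (sub_eq_zero.1 h1).symm⟩

end ConjugateTwist

end FixedAlgebra

/-! ### Reduced norms on the fixed algebra -/

section ReducedNorm

variable {L : Type} [Field L] [CharZero L] {G V : Type*} [Group G] [Fintype G] [AddCommGroup V]
  [Module L V] [FiniteDimensional L V]

instance finiteDimensional_fixedAlgebra (K : Subfield L) (ρ : Representation L G V) (α : MulAut G)
    (hα : α ^ 2 = 1) : FiniteDimensional K (fixedAlgebra K ρ α hα) :=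
  FiniteDimensional.span_of_finite K (Set.finite_range fun g => ρ g + ρ (α g))

namespace ConjugateTwist

variable {K : Subfield L} {c : L →+* L} {δ : L} {ρ : Representation L G V} {α : MulAut G}

/-- The multiplication map `L ⊗ A → End_L(V)` for the fixed algebra `A`. -/
def toEnd (K : Subfield L) (ρ : Representation L G V) {α : MulAut G} (hα : α ^ 2 = 1) :
    (L ⊗[K] fixedAlgebra K ρ α hα) →ₐ[L] Module.End L V :=
  Algebra.TensorProduct.lift (Algebra.ofId L (Module.End L V)) (fixedAlgebra K ρ α hα).val
    fun l _ => by
      rw [Algebra.ofId_apply]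
      exact Algebra.commute_algebraMap_left l _

theorem toEnd_tmul (hα : α ^ 2 = 1) (l : L) (a : fixedAlgebra K ρ α hα) :
    toEnd K ρ hα (l ⊗ₜ a) = l • (a : Module.End L V) := by
  rw [toEnd, Algebra.TensorProduct.lift_tmul, Algebra.smul_def]
  rfl

theorem toEnd_bijective (D : ConjugateTwist K c δ ρ α) :
    Function.Bijective (toEnd K ρ D.sq_eq_one) := by
  have hform : ∀ x : L ⊗[K] fixedAlgebra K ρ α D.sq_eq_one,
      ∃ a b, x = (1 : L) ⊗ₜ[K] a + δ ⊗ₜ[K] b := by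
    intro x
    induction x with
    | zero => exact ⟨0, 0, by simp⟩
    | add x y hx hy =>
      obtain ⟨a, b, rfl⟩ := hx
      obtain ⟨a', b', rfl⟩ := hy
      exact ⟨a + a', b + b', by rw [TensorProduct.tmul_add, TensorProduct.tmul_add]; abel⟩
    | tmul l a =>
      obtain ⟨p, q, rfl⟩ := D.exists_eq_add_delta_mul l
      refine ⟨p • a, q • a, ?_⟩
      rw [← TensorProduct.smul_tmul, ← TensorProduct.smul_tmul, TensorProduct.add_tmul,
        Subfield.smul_def, Subfield.smul_def, smul_eq_mul, smul_eq_mul, mul_one, mul_comm]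
  constructor
  · rw [injective_iff_map_eq_zero]
    intro x hx
    obtain ⟨a, b, rfl⟩ := hform x
    rw [map_add, toEnd_tmul, toEnd_tmul, one_smul] at hx
    have h := D.decomp_unique a.2 b.2 (zero_mem _) (zero_mem _)
      (hx.trans (by rw [smul_zero, add_zero]))
    have ha : a = 0 := Subtype.ext h.1
    have hb : b = 0 := Subtype.ext h.2
    rw [ha, hb, TensorProduct.tmul_zero, TensorProduct.tmul_zero, add_zero]
  · intro x
    obtain ⟨a, ha, b, hb, rfl⟩ := D.exists_decomp x
    refine ⟨(1 : L) ⊗ₜ[K] ⟨a, ha⟩ + δ ⊗ₜ[K] ⟨b, hb⟩, ?_⟩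
    rw [map_add, toEnd_tmul, toEnd_tmul, one_smul]

/-- Extension of scalars to `L` splits the fixed algebra. -/
def splitting (D : ConjugateTwist K c δ ρ α) :
    (L ⊗[K] fixedAlgebra K ρ α D.sq_eq_one) ≃ₐ[L]
      Matrix (Fin (Module.finrank L V)) (Fin (Module.finrank L V)) L :=
  (AlgEquiv.ofBijective _ D.toEnd_bijective).trans
    (LinearMap.toMatrixAlgEquiv (Module.finBasis L V))

theorem splitting_one_tmul (D : ConjugateTwist K c δ ρ α)
    (a : fixedAlgebra K ρ α D.sq_eq_one) :
    D.splitting (1 ⊗ₜ a) = LinearMap.toMatrixAlgEquiv (Module.finBasis L V)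
      (a : Module.End L V) := by
  rw [splitting, AlgEquiv.trans_apply, AlgEquiv.ofBijective_apply, toEnd_tmul, one_smul]

theorem charpoly_splitting (D : ConjugateTwist K c δ ρ α)
    (a : fixedAlgebra K ρ α D.sq_eq_one) :
    (D.splitting (1 ⊗ₜ a)).charpoly = LinearMap.charpoly (a : Module.End L V) := by
  rw [splitting_one_tmul]
  exact LinearMap.charpoly_toMatrix _ _

theorem finrank_fixedAlgebra (D : ConjugateTwist K c δ ρ α) :
    Module.finrank K (fixedAlgebra K ρ α D.sq_eq_one) = Module.finrank L V ^ 2 := by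
  rw [← Module.finrank_baseChange (R := L), D.splitting.toLinearEquiv.finrank_eq,
    Module.finrank_matrix, Fintype.card_fin, Module.finrank_self, mul_one, pow_two]

theorem finrank_ne_zero (D : ConjugateTwist K c δ ρ α) : Module.finrank L V ≠ 0 := by
  have := finrank_cast_ne_zero D.sum_char
  exact_mod_cast this

theorem exists_map_eq (D : ConjugateTwist K c δ ρ α) {p : L[X]} (hp : p.map c = p) :
    ∃ q : K[X], q.map (algebraMap K L) = p := by
  have : p ∈ Polynomial.lifts (algebraMap K L) := by
    rw [Polynomial.lifts_iff_coeff_lifts]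
    intro i
    refine ⟨⟨p.coeff i, ?_⟩, rfl⟩
    rw [D.mem_iff, ← Polynomial.coeff_map, hp]
  exact this

theorem map_comp_algebraMap (D : ConjugateTwist K c δ ρ α) (q : K[X]) :
    (q.map (algebraMap K L)).map c = q.map (algebraMap K L) := by
  rw [Polynomial.map_map]
  congr 1
  ext x
  exact (D.mem_iff x).1 x.2

/-- Its `n`-th power is the characteristic polynomial of left multiplication over `K`, hence fixed
by `c`; monic `n`-th roots are unique, so it is fixed itself. -/
theorem exists_charpoly_eq_map (D : ConjugateTwist K c δ ρ α)
    (a : fixedAlgebra K ρ α D.sq_eq_one) :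
    ∃ q : K[X], q.map (algebraMap K L) = LinearMap.charpoly (a : Module.End L V) := by
  refine D.exists_map_eq ?_
  have h := map_charpoly_mulLeft_eq D.splitting a
  rw [charpoly_splitting] at h
  refine eq_of_monic_of_pow_eq ((LinearMap.charpoly_monic _).map _) (LinearMap.charpoly_monic _)
    D.finrank_ne_zero ?_
  rw [← Polynomial.map_pow, ← h, map_comp_algebraMap D]

theorem exists_det_eq (D : ConjugateTwist K c δ ρ α) (a : fixedAlgebra K ρ α D.sq_eq_one) :
    ∃ k : K, (k : L) = LinearMap.det (a : Module.End L V) := by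
  obtain ⟨q, hq⟩ := D.exists_charpoly_eq_map a
  refine ⟨(-1) ^ Module.finrank L V * q.coeff 0, ?_⟩
  rw [LinearMap.det_eq_sign_charpoly_coeff, ← hq, Polynomial.coeff_map]
  push_cast
  rfl

/-- Independence of the splitting field: over any `E` the characteristic polynomial of the matrix is
the monic `n`-th root of the same polynomial over `K`, and that root already exists over `K`. -/
theorem isReducedNorm_iff (D : ConjugateTwist K c δ ρ α)
    (a : fixedAlgebra K ρ α D.sq_eq_one) (k : K) :
    IsReducedNorm a k ↔ (k : L) = LinearMap.det (a : Module.End L V) := by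
  constructor
  · rintro ⟨E, _, _, n, f, hf⟩
    have hn : n = Module.finrank L V := by
      have h := f.toLinearEquiv.finrank_eq
      rw [Module.finrank_baseChange, D.finrank_fixedAlgebra, Module.finrank_matrix,
        Fintype.card_fin, Module.finrank_self, mul_one, ← pow_two] at h
      exact (Nat.pow_left_injective two_ne_zero h).symm
    obtain ⟨q, hq⟩ := D.exists_charpoly_eq_map a
    have h1 := map_charpoly_mulLeft_eq D.splitting a
    rw [charpoly_splitting, ← hq, ← Polynomial.map_pow] at h1
    have h2 := Polynomial.map_injective _ (algebraMap K L).injective h1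
    have h3 := map_charpoly_mulLeft_eq f a
    rw [h2, Polynomial.map_pow, ← hn] at h3
    have hqm : q.Monic := by
      refine Polynomial.monic_of_injective (algebraMap K L).injective ?_
      rw [hq]
      exact LinearMap.charpoly_monic _
    have h4 := eq_of_monic_of_pow_eq (hqm.map _) (Matrix.charpoly_monic _) (hn.trans_ne D.finrank_ne_zero) h3
    rw [Matrix.det_eq_sign_charpoly_coeff, ← h4, Polynomial.coeff_map, Fintype.card_fin] at hf
    have h5 : k = (-1) ^ n * q.coeff 0 := by
      apply (algebraMap K E).injective
      rw [← hf, map_mul, map_pow, map_neg, map_one]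
    rw [LinearMap.det_eq_sign_charpoly_coeff, ← hq, Polynomial.coeff_map, h5, hn]
    push_cast
    rfl
  · intro h
    refine ⟨L, inferInstance, inferInstance, _, D.splitting, ?_⟩
    rw [splitting_one_tmul]
    exact (LinearMap.det_toMatrix _ _).trans h.symm

/-- Left multiplication by `a` on the finite-dimensional fixed algebra is injective, hence
surjective, so the inverse lies in that algebra. -/
theorem isUnit_iff (D : ConjugateTwist K c δ ρ α) (a : fixedAlgebra K ρ α D.sq_eq_one) :
    IsUnit a ↔ LinearMap.det (a : Module.End L V) ≠ 0 := by
  constructor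
  · intro h
    exact ((h.map (fixedAlgebra K ρ α D.sq_eq_one).val).map LinearMap.det).ne_zero
  · intro h
    have hu : IsUnit (a : Module.End L V) := (LinearMap.isUnit_iff_isUnit_det _).2 h.isUnit
    have hinj : Function.Injective (LinearMap.mulLeft K a) := by
      rw [injective_iff_map_eq_zero]
      intro x hx
      have hx' := congrArg Subtype.val hx
      exact Subtype.ext (hu.mul_left_cancel (hx'.trans (mul_zero _).symm))
    obtain ⟨b, hb⟩ := LinearMap.surjective_of_injective hinj 1
    have hb' : a * b = 1 := hb
    refine ⟨⟨a, b, hb', Subtype.ext (hu.mul_left_cancel ?_)⟩, rfl⟩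
    have := congrArg Subtype.val hb'
    change (a : Module.End L V) * (b * a) = a * 1
    rw [← mul_assoc, show (a : Module.End L V) * b = 1 from this, one_mul, mul_one]

end ConjugateTwist

end ReducedNorm

/-! ### Skew elements -/

section Skew

open scoped Matrix

/-- The determinant is a nonzero polynomial in the parameter. Replacing `δ` by a natural number
keeps the combination inside the fixed algebra. -/
theorem exists_nat_det_add_smul_ne_zero {F n : Type*} [Field F] [CharZero F] [Fintype n]
    [DecidableEq n] {M N : Matrix n n F} {t : F} (h : (M + t • N).det ≠ 0) :
    ∃ k : ℕ, (M + (k : F) • N).det ≠ 0 := by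
  let P : Matrix n n F[X] := M.map Polynomial.C + (Polynomial.X : F[X]) • N.map Polynomial.C
  have hP : ∀ x, P.det.eval x = (M + x • N).det := by
    intro x
    rw [← Polynomial.coe_evalRingHom, RingHom.map_det]
    congr 1
    ext i j
    simpa [P] using mul_comm _ _
  by_contra! hk
  have : P.det = 0 := by
    refine Polynomial.eq_zero_of_infinite_isRoot _ ?_
    refine (Set.infinite_range_of_injective (Nat.cast_injective (R := F))).mono ?_
    rintro _ ⟨k, rfl⟩
    exact (hP k).trans (hk k)
  exact h (by rw [← hP, this, Polynomial.eval_zero])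

theorem exists_skew_matrix (F : Type*) [Field F] {n : ℕ} (hn : Even n) :
    ∃ J : Matrix (Fin n) (Fin n) F, Jᵀ = -J ∧ J.det ≠ 0 := by
  obtain ⟨m, rfl⟩ := hn
  refine ⟨Matrix.reindex finSumFinEquiv finSumFinEquiv (Matrix.J (Fin m) F), ?_, ?_⟩
  · rw [Matrix.transpose_reindex, Matrix.J_transpose]
    rfl
  · rw [Matrix.det_reindex_self]
    exact (Matrix.isUnit_det_J _ _).ne_zero

/-- The endomorphism `a` is skew for the bilinear form `B`. -/
def BilinSkew {L V : Type*} [Field L] [AddCommGroup V] [Module L V] (B : LinearMap.BilinForm L V)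
    (a : Module.End L V) : Prop :=
  ∀ v w, B (a v) w = -B v (a w)

section Matrix

variable {L V : Type*} [Field L] [AddCommGroup V] [Module L V] {n : Type} [Fintype n]
  [DecidableEq n] {B : LinearMap.BilinForm L V}

theorem transpose_toMatrix (b : Module.Basis n L V) (hsymm : B.flip = B) :
    (LinearMap.BilinForm.toMatrix b B)ᵀ = LinearMap.BilinForm.toMatrix b B := by
  ext i j
  rw [Matrix.transpose_apply, LinearMap.BilinForm.toMatrix_apply,
    LinearMap.BilinForm.toMatrix_apply]
  exact LinearMap.congr_fun₂ hsymm (b i) (b j)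

theorem bilinSkew_iff (b : Module.Basis n L V) (hsymm : B.flip = B) (a : Module.End L V) :
    BilinSkew B a ↔ (LinearMap.BilinForm.toMatrix b B * LinearMap.toMatrix b b a)ᵀ =
      -(LinearMap.BilinForm.toMatrix b B * LinearMap.toMatrix b b a) := by
  rw [Matrix.transpose_mul, transpose_toMatrix b hsymm, ← LinearMap.BilinForm.toMatrix_compLeft,
    ← LinearMap.BilinForm.toMatrix_compRight, ← map_neg, EmbeddingLike.apply_eq_iff_eq,
    LinearMap.ext_iff₂]
  rfl

end Matrix

section Hermitian

variable {L : Type} [Field L] {G V : Type*} [Group G] [AddCommGroup V] [Module L V]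

/-- The form `H` is a non-degenerate Hermitian form with respect to `c`, invariant under `ρ`. -/
structure HermitianFor (c : L →+* L) (ρ : Representation L G V) (H : V → V → L) : Prop where
  add_left : ∀ v v' w, H (v + v') w = H v w + H v' w
  smul_left : ∀ (a : L) v w, H (a • v) w = a * H v w
  conj_symm : ∀ v w, H v w = c (H w v)
  nondegenerate : ∀ v, (∀ w, H v w = 0) → v = 0
  invariant : ∀ g v w, H (ρ g v) (ρ g w) = H v w

namespace HermitianFor

variable {c : L →+* L} {ρ : Representation L G V} {H : V → V → L} (hH : HermitianFor c ρ H)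
include hH

theorem add_right (v w w' : V) : H v (w + w') = H v w + H v w' := by
  rw [hH.conj_symm, hH.add_left, map_add, ← hH.conj_symm, ← hH.conj_symm]

theorem smul_right (a : L) (v w : V) : H v (a • w) = c a * H v w := by
  rw [hH.conj_symm, hH.smul_left, map_mul, ← hH.conj_symm]

theorem zero_right (v : V) : H v 0 = 0 := by
  rw [← zero_smul L (0 : V), hH.smul_right, map_zero, zero_mul]

theorem zero_left (v : V) : H 0 v = 0 := by
  rw [← zero_smul L (0 : V), hH.smul_left, zero_mul]

theorem apply_left (g : G) (v w : V) : H (ρ g v) w = H v (ρ g⁻¹ w) := by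
  rw [← hH.invariant g v (ρ g⁻¹ w), ← Module.End.mul_apply, ← map_mul, mul_inv_cancel, map_one,
    Module.End.one_apply]

end HermitianFor

end Hermitian

variable {L : Type} [Field L] [CharZero L] {G V : Type*} [Group G] [Fintype G] [AddCommGroup V]
  [Module L V] [FiniteDimensional L V]

namespace ConjugateTwist

variable {K : Subfield L} {c : L →+* L} {δ : L} {ρ : Representation L G V} {α : MulAut G}
  (D : ConjugateTwist K c δ ρ α) {B : LinearMap.BilinForm L V}

section
include D

/-- The adjoint involutions of `H` and `B` agree on the fixed algebra. -/
theorem exists_adjoint (hB : TwistedInvariant ρ α B) {H : V → V → L} (hH : HermitianFor c ρ H)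
    {a : Module.End L V} (ha : a ∈ fixedSpan K ρ α) :
    ∃ a' ∈ fixedSpan K ρ α, (∀ v w, B (a v) w = B v (a' w)) ∧ ∀ v w, H (a v) w = H v (a' w) := by
  induction ha using Submodule.span_induction with
  | zero => exact ⟨0, zero_mem _, by simp, by simp [hH.zero_left, hH.zero_right]⟩
  | add a b _ _ ha hb =>
    obtain ⟨a', ha', h1, h2⟩ := ha
    obtain ⟨b', hb', h3, h4⟩ := hb
    refine ⟨a' + b', add_mem ha' hb', fun v w => ?_, fun v w => ?_⟩
    · simp [h1, h3]
    · rw [LinearMap.add_apply, LinearMap.add_apply, hH.add_left, hH.add_right, h2, h4]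
  | smul k a _ ha =>
    obtain ⟨a', ha', h1, h2⟩ := ha
    refine ⟨k • a', Submodule.smul_mem _ _ ha', fun v w => ?_, fun v w => ?_⟩
    · simp only [Subfield.smul_def, LinearMap.smul_apply, map_smul, h1]
    · rw [Subfield.smul_def, Subfield.smul_def, LinearMap.smul_apply, LinearMap.smul_apply,
        hH.smul_left, hH.smul_right, h2, (D.mem_iff k).1 k.2]
  | mem a ha =>
    obtain ⟨g, rfl⟩ := ha
    -- The adjoint for `H` sends `ρ g` to `ρ g⁻¹`, that for `B` to `ρ (α g⁻¹)`; on the symmetric sum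
    -- the two agree.
    refine ⟨ρ g⁻¹ + ρ (α g⁻¹), Submodule.subset_span ⟨g⁻¹, rfl⟩, fun v w => ?_, fun v w => ?_⟩
    · have hadj : ∀ g v w, B (ρ g v) w = B v (ρ (α g⁻¹) w) := by
        intro g v w
        rw [← hB g v (ρ (α g⁻¹) w), ← Module.End.mul_apply, ← map_mul, ← map_mul, mul_inv_cancel,
          map_one, map_one, Module.End.one_apply]
      simp only [LinearMap.add_apply, map_add, hadj, ← map_inv, D.apply_apply]
      exact add_comm _ _
    · simp only [LinearMap.add_apply, hH.add_left, hH.add_right, hH.apply_left, map_inv]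

theorem eq_zero_of_apply_right (hB : TwistedInvariant ρ α B) (hB0 : B ≠ 0) (hsymm : B.flip = B)
    {x : Module.End L V} (h : ∀ v w, B v (x w) = 0) : x = 0 := by
  ext w
  refine hB.injective D.sum_char hB0 (LinearMap.ext fun v => ?_)
  rw [LinearMap.zero_apply, map_zero, LinearMap.zero_apply]
  exact (LinearMap.congr_fun₂ hsymm _ _).symm.trans (h v w)

theorem isSkew_iff (hB : TwistedInvariant ρ α B) (hB0 : B ≠ 0) (hsymm : B.flip = B)
    {H : V → V → L} (hH : HermitianFor c ρ H)
    {a : Module.End L V} (ha : a ∈ fixedSpan K ρ α) : IsSkew H a ↔ BilinSkew B a := by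
  obtain ⟨a', -, h1, h2⟩ := D.exists_adjoint hB hH ha
  have e1 : IsSkew H a ↔ a' = -a := by
    constructor
    · intro h
      rw [← sub_eq_zero]
      ext w
      rw [LinearMap.zero_apply]
      refine hH.nondegenerate _ fun v => ?_
      have h3 : H v ((a' - -a) w) = 0 := by
        rw [LinearMap.sub_apply, sub_eq_add_neg, ← neg_one_smul L ((-a) w), hH.add_right,
          hH.smul_right, ← h2, h v w, map_neg, map_one, neg_one_mul, add_neg_cancel]
      rw [hH.conj_symm, h3, map_zero]
    · rintro rfl
      exact h2
  have e2 : BilinSkew B a ↔ a' = -a := by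
    constructor
    · intro h
      rw [← sub_eq_zero]
      refine D.eq_zero_of_apply_right hB hB0 hsymm fun v w => ?_
      rw [LinearMap.sub_apply, map_sub, ← h1, h v w, LinearMap.neg_apply, map_neg, sub_self]
    · rintro rfl v w
      rw [h1, LinearMap.neg_apply, map_neg]
  rw [e1, e2]

/-- As `n` is even, `S⁻¹ J` is an invertible skew element over `L`. The adjoint of `B` is `L`-linear
and preserves the fixed span, so both components in `a + δ b` are skew, and some `a + k b` with `k`
natural is invertible. -/
theorem exists_skew (hB : TwistedInvariant ρ α B) (hB0 : B ≠ 0) (hsymm : B.flip = B)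
    {H : V → V → L} (hH : HermitianFor c ρ H) (heven : Even (Module.finrank L V)) :
    ∃ a ∈ fixedSpan K ρ α, BilinSkew B a ∧ LinearMap.det a ≠ 0 := by
  let β := Module.finBasis L V
  have hnd : B.Nondegenerate :=
    LinearMap.BilinForm.nondegenerate_iff_ker_eq_bot.2
      (LinearMap.ker_eq_bot.2 (hB.injective D.sum_char hB0))
  have hdet := (LinearMap.BilinForm.nondegenerate_iff_det_ne_zero β).1 hnd
  set S := LinearMap.BilinForm.toMatrix β B with hS
  obtain ⟨J, hJ, hJdet⟩ := exists_skew_matrix L heven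
  set x := Matrix.toLin β β (S⁻¹ * J) with hx
  have hxm : LinearMap.toMatrix β β x = S⁻¹ * J := LinearMap.toMatrix_toLin _ _ _
  have hxskew : BilinSkew B x := by
    rw [bilinSkew_iff β hsymm, hxm, ← hS, Matrix.mul_nonsing_inv_cancel_left _ _ hdet.isUnit, hJ]
  obtain ⟨a, ha, b, hb, hab⟩ := D.exists_decomp x
  obtain ⟨a', ha', h1, -⟩ := D.exists_adjoint hB hH ha
  obtain ⟨b', hb', h2, -⟩ := D.exists_adjoint hB hH hb
  have h3 : a' + δ • b' = -a + δ • -b := by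
    rw [← sub_eq_zero]
    refine D.eq_zero_of_apply_right hB hB0 hsymm fun v w => ?_
    have h := hxskew v w
    rw [hab] at h
    simp only [LinearMap.add_apply, LinearMap.smul_apply, LinearMap.sub_apply,
      LinearMap.neg_apply, map_add, map_sub, map_smul, map_neg, h1, h2, smul_eq_mul,
      neg_add] at h ⊢
    rw [h]
    ring
  obtain ⟨h4, h5⟩ := D.decomp_unique ha' hb' (neg_mem ha) (neg_mem hb) h3
  have hdx : (LinearMap.toMatrix β β a + δ • LinearMap.toMatrix β β b).det ≠ 0 := by
    rw [← map_smul, ← map_add, ← hab, hxm, Matrix.det_mul, Matrix.det_nonsing_inv,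
      Ring.inverse_eq_inv']
    exact mul_ne_zero (inv_ne_zero hdet) hJdet
  obtain ⟨k, hk⟩ := exists_nat_det_add_smul_ne_zero hdx
  rw [← map_smul, ← map_add, LinearMap.det_toMatrix] at hk
  refine ⟨_, ?_, ?_, hk⟩
  · rw [Nat.cast_smul_eq_nsmul]
    exact add_mem ha (nsmul_mem hb k)
  · intro v w
    simp only [LinearMap.add_apply, LinearMap.smul_apply, map_add, map_smul, h1, h2, h4, h5,
      LinearMap.neg_apply, map_neg, smul_neg, neg_add]

end

/-- The matrix of `x = a⁻¹ b` is `(S a)⁻¹ (S b)`, a quotient of skew matrices, so its characteristic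
polynomial is `p²` with `p` monic. Uniqueness of `p` makes it `c`-fixed, so `p(0)` lies in `K`;
determinants alone would give only a square in `L`. -/
theorem exists_det_eq_mul_sq (hB : TwistedInvariant ρ α B) (hB0 : B ≠ 0) (hsymm : B.flip = B)
    (heven : Even (Module.finrank L V)) {a b : fixedAlgebra K ρ α D.sq_eq_one}
    (ha : BilinSkew B (a : Module.End L V)) (hb : BilinSkew B (b : Module.End L V))
    (ha0 : LinearMap.det (a : Module.End L V) ≠ 0) :
    ∃ s : K, LinearMap.det (b : Module.End L V) =
      LinearMap.det (a : Module.End L V) * (s : L) ^ 2 := by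
  let β := Module.finBasis L V
  have hnd : B.Nondegenerate :=
    LinearMap.BilinForm.nondegenerate_iff_ker_eq_bot.2
      (LinearMap.ker_eq_bot.2 (hB.injective D.sum_char hB0))
  have hdet := (LinearMap.BilinForm.nondegenerate_iff_det_ne_zero β).1 hnd
  obtain ⟨u, hu⟩ := (D.isUnit_iff a).2 ha0
  let x : fixedAlgebra K ρ α D.sq_eq_one := ↑u⁻¹ * b
  have hbx : (b : Module.End L V) = a * x := by
    have : b = a * x := by rw [← hu, Units.mul_inv_cancel_left]
    exact congrArg Subtype.val this
  rw [bilinSkew_iff β hsymm] at ha hb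
  set S := LinearMap.BilinForm.toMatrix β B
  set Ma := LinearMap.toMatrix β β (a : Module.End L V) with hMa
  set Mb := LinearMap.toMatrix β β (b : Module.End L V) with hMb
  have hMa0 : Ma.det ≠ 0 := by rwa [hMa, LinearMap.det_toMatrix]
  have hSMa : IsUnit (S * Ma).det := by
    rw [Matrix.det_mul]
    exact (mul_ne_zero hdet hMa0).isUnit
  obtain ⟨p, hpm, hp⟩ := exists_monic_charpoly_eq_sq _ _ ha hb hSMa
  have hxm : (S * Ma)⁻¹ * (S * Mb) = LinearMap.toMatrix β β (x : Module.End L V) := by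
    rw [hMb, hbx, LinearMap.toMatrix_mul, ← hMa, ← Matrix.mul_assoc S Ma,
      Matrix.nonsing_inv_mul_cancel_left _ _ hSMa]
  rw [hxm, LinearMap.charpoly_toMatrix] at hp
  obtain ⟨q, hq⟩ := D.exists_charpoly_eq_map x
  have hpc : p.map c = p := by
    refine eq_of_monic_of_pow_eq (hpm.map _) hpm two_ne_zero ?_
    rw [← Polynomial.map_pow, ← hp, ← hq, D.map_comp_algebraMap]
  obtain ⟨r, rfl⟩ := D.exists_map_eq hpc
  refine ⟨r.coeff 0, ?_⟩
  rw [hbx, map_mul, LinearMap.det_eq_sign_charpoly_coeff (x : Module.End L V), hp,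
    heven.neg_one_pow, one_mul, pow_two (Polynomial.map _ _), Polynomial.mul_coeff_zero,
    Polynomial.coeff_map, pow_two]
  rfl

theorem isSquare_det_mul_det (hsymm : B.flip = B) {n : Type} [Fintype n] [DecidableEq n]
    (b : Module.Basis n L V) {a : Module.End L V} (ha : BilinSkew B a) :
    IsSquare ((LinearMap.BilinForm.toMatrix b B).det * LinearMap.det a) := by
  rw [← LinearMap.det_toMatrix b, ← Matrix.det_mul]
  exact isSquare_det_of_skew _ _ rfl ((bilinSkew_iff b hsymm a).1 ha)

end ConjugateTwist

end Skew

/-! ### The discriminant class and its valuation -/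

section Discriminant

namespace ConjugateTwist

variable {L : Type} [Field L] [CharZero L] {G V : Type*} [Group G] [Fintype G] [AddCommGroup V]
  [Module L V] [FiniteDimensional L V]
  {K : Subfield L} {c : L →+* L} {δ : L} {ρ : Representation L G V} {α : MulAut G}
  (D : ConjugateTwist K c δ ρ α) {B : LinearMap.BilinForm L V}

/-- Trades the reduced norm and `ι_H` for the determinant over `L` and `B`; the dimension of the
fixed algebra fixes `m`. -/
theorem mem_discClass_iff (hB : TwistedInvariant ρ α B) (hB0 : B ≠ 0) (hsymm : B.flip = B)
    {H : V → V → L} (hH : HermitianFor c ρ H) {m : ℕ} (hm : Module.finrank L V = 2 * m) (d : Kˣ) :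
    d ∈ discClass K {a : fixedAlgebra K ρ α D.sq_eq_one | IsSkew H (a : Module.End L V)} ↔
      ∃ (a : fixedAlgebra K ρ α D.sq_eq_one) (s : Kˣ), BilinSkew B (a : Module.End L V) ∧
        LinearMap.det (a : Module.End L V) ≠ 0 ∧
        ((d : K) : L) = (-1) ^ m * LinearMap.det (a : Module.End L V) * ((s : K) : L) ^ 2 := by
  constructor
  · rintro ⟨m', a, k, s, hm', ha, hau, hk, hd⟩
    have hmm : m' = m := by
      rw [D.finrank_fixedAlgebra, hm] at hm'
      have := Nat.pow_left_injective two_ne_zero hm'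
      omega
    subst hmm
    refine ⟨a, s, (D.isSkew_iff hB hB0 hsymm hH a.2).1 ha, (D.isUnit_iff a).1 hau, ?_⟩
    rw [hd, ← (D.isReducedNorm_iff a k).1 hk]
    push_cast
    rfl
  · rintro ⟨a, s, ha, ha0, hd⟩
    obtain ⟨k, hk⟩ := D.exists_det_eq a
    refine ⟨m, a, k, s, by rw [D.finrank_fixedAlgebra, hm],
      (D.isSkew_iff hB hB0 hsymm hH a.2).2 ha, (D.isUnit_iff a).2 ha0,
      (D.isReducedNorm_iff a k).2 hk, ?_⟩
    apply Subtype.ext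
    rw [hd, ← hk]
    push_cast
    rfl

theorem exists_discClass_eq (hB : TwistedInvariant ρ α B) (hB0 : B ≠ 0) (hsymm : B.flip = B)
    {H : V → V → L} (hH : HermitianFor c ρ H) {m : ℕ} (hm : Module.finrank L V = 2 * m) :
    ∃ d₀ : Kˣ,
      discClass K {a : fixedAlgebra K ρ α D.sq_eq_one | IsSkew H (a : Module.End L V)} =
        {d | ∃ s : Kˣ, d = d₀ * s ^ 2} := by
  have heven : Even (Module.finrank L V) := hm ▸ even_two_mul m
  obtain ⟨a, ha, hskew, hdet⟩ := D.exists_skew hB hB0 hsymm hH heven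
  obtain ⟨k, hk⟩ := D.exists_det_eq ⟨a, ha⟩
  have hk0 : (-1) ^ m * k ≠ 0 := by
    refine mul_ne_zero (pow_ne_zero _ (neg_ne_zero.2 one_ne_zero)) fun h => hdet ?_
    rw [← show (k : L) = LinearMap.det a from hk, h]
    rfl
  have hval : (((Units.mk0 _ hk0 : Kˣ) : K) : L) = (-1) ^ m * LinearMap.det a := by
    rw [Units.val_mk0, ← show (k : L) = LinearMap.det a from hk]
    push_cast
    rfl
  refine ⟨Units.mk0 _ hk0, Set.ext fun d => ?_⟩
  rw [D.mem_discClass_iff hB hB0 hsymm hH hm, Set.mem_ofPred_eq]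
  constructor
  · rintro ⟨b, s, hb, hb0, hd⟩
    obtain ⟨r, hr⟩ := D.exists_det_eq_mul_sq hB hB0 hsymm heven (a := ⟨a, ha⟩) hskew hb hdet
    have hr0 : r ≠ 0 := by
      rintro rfl
      exact hb0 (by rw [hr]; simp)
    refine ⟨Units.mk0 r hr0 * s, Units.ext (Subtype.ext ?_)⟩
    rw [hd, hr]
    simp only [Units.val_mul, Units.val_pow_eq_pow_val, Subfield.coe_mul, SubmonoidClass.coe_pow, hval,
      Units.val_mk0 hr0]
    ring
  · rintro ⟨s, rfl⟩
    refine ⟨⟨a, ha⟩, s, hskew, hdet, ?_⟩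
    simp only [Units.val_mul, Units.val_pow_eq_pow_val, Subfield.coe_mul, SubmonoidClass.coe_pow, hval]

/-- Both `det S * det a` and `det S` have square value, hence so has `det a`; the sign and the
factor `s²` do not matter. -/
theorem isSquare_valuation_of_mem_discClass (hB : TwistedInvariant ρ α B) (hB0 : B ≠ 0)
    (hsymm : B.flip = B) {H : V → V → L} (hH : HermitianFor c ρ H) {m : ℕ}
    (hm : Module.finrank L V = 2 * m) {Γ₀ : Type*} [LinearOrderedCommGroupWithZero Γ₀]
    (val : Valuation L Γ₀) [IsPrincipalIdealRing val.valuationSubring]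
    (hval : val (Nat.card G : L) = 1) {d : Kˣ}
    (hd : d ∈ discClass K
      {a : fixedAlgebra K ρ α D.sq_eq_one | IsSkew H (a : Module.End L V)}) :
    IsSquare (val ((d : K) : L)) := by
  obtain ⟨a, s, ha, -, hda⟩ := (D.mem_discClass_iff hB hB0 hsymm hH hm d).1 hd
  obtain ⟨b, hb⟩ := isSquare_valuation_det_twisted val D.sum_char hval hB hB0
    (hm ▸ even_two_mul m)
  have hnd : B.Nondegenerate :=
    LinearMap.BilinForm.nondegenerate_iff_ker_eq_bot.2
      (LinearMap.ker_eq_bot.2 (hB.injective D.sum_char hB0))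
  have hdet := (LinearMap.BilinForm.nondegenerate_iff_det_ne_zero b).1 hnd
  have h1 := (isSquare_det_mul_det hsymm b ha).map val
  rw [map_mul] at h1
  have h2 : IsSquare (val (LinearMap.det (a : Module.End L V))) := by
    have := h1.div hb
    rwa [mul_div_cancel_left₀ _ ((Valuation.ne_zero_iff _).2 hdet)] at this
  rw [hda, map_mul, map_mul, map_pow, map_pow, Valuation.map_neg, map_one, one_pow, one_mul]
  exact h2.mul (IsSquare.sq _)

end ConjugateTwist

end Discriminant

/-! ### Complex conjugation on the character field -/

section CharacterField

open scoped Matrix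

/-- The Gram matrix of `H` conjugates the `c`-image of the matrix of `ρ g⁻¹` into the transpose of
that of `ρ g`; compare traces. -/
theorem HermitianFor.conj_character {L : Type} [Field L] {G V : Type*} [Group G]
    [AddCommGroup V] [Module L V] [FiniteDimensional L V] {c : L →+* L}
    {ρ : Representation L G V} {H : V → V → L} (hH : HermitianFor c ρ H) (g : G) :
    ρ.character g = c (ρ.character g⁻¹) := by
  let b := Module.finBasis L V
  let h : Matrix _ _ L := Matrix.of fun i j => H (b i) (b j)
  have hsumr : ∀ {ι : Type} (s : Finset ι) (v : V) (x : ι → L) (y : ι → V),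
      H v (∑ i ∈ s, x i • y i) = ∑ i ∈ s, c (x i) * H v (y i) := by
    intro ι s v x y
    induction s using Finset.cons_induction with
    | empty => simp [hH.zero_right]
    | cons i s hi ih => rw [Finset.sum_cons, Finset.sum_cons, hH.add_right, hH.smul_right, ih]
  have hsuml : ∀ {ι : Type} (s : Finset ι) (v : V) (x : ι → L) (y : ι → V),
      H (∑ i ∈ s, x i • y i) v = ∑ i ∈ s, x i * H (y i) v := by
    intro ι s v x y
    induction s using Finset.cons_induction with
    | empty => simp [hH.zero_left]
    | cons i s hi ih => rw [Finset.sum_cons, Finset.sum_cons, hH.add_left, hH.smul_left, ih]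
  have hdet : h.det ≠ 0 := by
    intro h0
    obtain ⟨x, hx0, hx⟩ := Matrix.exists_vecMul_eq_zero_iff.2 h0
    have hv : ∑ i, x i • b i = 0 := by
      refine hH.nondegenerate _ fun w => ?_
      rw [← b.sum_repr w, hsumr]
      refine Finset.sum_eq_zero fun j _ => ?_
      rw [hsuml]
      have : ∑ i, x i * H (b i) (b j) = 0 := congrFun hx j
      rw [this, mul_zero]
    exact hx0 (funext (Fintype.linearIndependent_iff.1 b.linearIndependent x hv))
  have hadj : (LinearMap.toMatrix b b (ρ g))ᵀ * h =
      h * (c.mapMatrix (LinearMap.toMatrix b b (ρ g⁻¹))) := by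
    ext i j
    have h1 := hH.apply_left g (b i) (b j)
    rw [← b.sum_repr (ρ g (b i)), ← b.sum_repr (ρ g⁻¹ (b j)), hsuml, hsumr] at h1
    rw [Matrix.mul_apply, Matrix.mul_apply]
    simp only [Matrix.transpose_apply, LinearMap.toMatrix_apply, RingHom.mapMatrix_apply,
      Matrix.map_apply]
    refine h1.trans (Finset.sum_congr rfl fun k _ => mul_comm _ _)
  have hconj : (LinearMap.toMatrix b b (ρ g))ᵀ =
      h * (c.mapMatrix (LinearMap.toMatrix b b (ρ g⁻¹))) * h⁻¹ := by
    rw [← hadj, Matrix.mul_nonsing_inv_cancel_right _ _ hdet.isUnit]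
  rw [Representation.character, Representation.character, LinearMap.trace_eq_matrix_trace L b,
    LinearMap.trace_eq_matrix_trace L b, ← Matrix.trace_transpose, hconj, Matrix.trace_mul_comm,
    Matrix.nonsing_inv_mul_cancel_left _ _ hdet.isUnit, RingHom.mapMatrix_apply,
    AddMonoidHom.map_trace]

theorem conj_mem_charField {G : Type*} [Group G] {χ : G → ℂ} {α : MulAut G}
    (hχα : ∀ g, χ (α g) = conj (χ g)) (x : charField χ) : conj (x : ℂ) ∈ charField χ := by
  have h : charField χ ≤ (charField χ).comap (starRingEnd ℂ).toRatAlgHom := by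
    rw [IntermediateField.adjoin_le_iff]
    rintro _ ⟨g, rfl⟩
    exact IntermediateField.subset_adjoin ℚ _ ⟨α g, hχα g⟩
  exact h x.2

/-- Complex conjugation on the character field. -/
def charConj {G : Type*} [Group G] {χ : G → ℂ} {α : MulAut G}
    (hχα : ∀ g, χ (α g) = conj (χ g)) : charField χ →+* charField χ :=
  ((starRingEnd ℂ).comp (algebraMap (charField χ) ℂ)).codRestrict (charField χ)
    (conj_mem_charField hχα)

theorem coe_charConj {G : Type*} [Group G] {χ : G → ℂ} {α : MulAut G}
    (hχα : ∀ g, χ (α g) = conj (χ g)) (x : charField χ) :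
    (charConj hχα x : ℂ) = conj (x : ℂ) := rfl

theorem mem_realField_iff {G : Type*} {χ : G → ℂ} (x : charField χ) :
    x ∈ realField χ ↔ conj (x : ℂ) = x := by
  rw [Complex.conj_eq_iff_real]
  exact exists_congr fun r => eq_comm

theorem numberField_realField {G : Type*} [Group G] [Finite G] {χ : G → ℂ} (hχ : IsIrrChar χ) :
    NumberField (realField χ) := by
  have := numberField_charField hχ
  have : FiniteDimensional ℚ (realField χ) :=
    FiniteDimensional.of_injective
      ((realField χ).subtype.toRatAlgHom).toLinearMap Subtype.val_injective
  exact { to_finiteDimensional := this }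

variable {G : Type*} [Group G] [Fintype G] {χ : G → ℂ} {V : Type*} [AddCommGroup V]
  [Module (charField χ) V] [FiniteDimensional (charField χ) V]
  {ρ : Representation (charField χ) G V} {H : V → V → charField χ} {α : MulAut G}

theorem IsInvariantHermitian.hermitianFor (hH : IsInvariantHermitian ρ H)
    (hχα : ∀ g, χ (α g) = conj (χ g)) : HermitianFor (charConj hχα) ρ H where
  add_left := hH.add_left
  smul_left := hH.smul_left
  conj_symm v w := Subtype.ext (hH.conj_symm v w)
  nondegenerate := hH.nondegenerate
  invariant := hH.invariant

theorem IsInvariantHermitian.apply_inv (hH : IsInvariantHermitian ρ H)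
    (hχα : ∀ g, χ (α g) = conj (χ g)) (hρ : ∀ g, ((ρ.character g : charField χ) : ℂ) = χ g)
    (g : G) : χ g⁻¹ = conj (χ g) := by
  have h := congrArg (algebraMap (charField χ) ℂ) ((hH.hermitianFor hχα).conj_character g⁻¹)
  rw [inv_inv] at h
  rw [← hρ, ← hρ]
  exact h

theorem IsIrrChar.exists_conjugateTwist (hχ : IsIrrChar χ) (hχo : IndicatorO χ)
    (hρ : ∀ g, ((ρ.character g : charField χ) : ℂ) = χ g) (hH : IsInvariantHermitian ρ H)
    (hα : α ^ 2 = 1) (hχα : ∀ g, χ (α g) = conj (χ g)) :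
    ∃ δ, ConjugateTwist (realField χ) (charConj hχα) δ ρ α := by
  have hinv := hH.apply_inv hχα hρ
  obtain ⟨n, τ, hτ, hs'⟩ := hχ.exists_rep
  have hs : ∑ g, ρ.character g * ρ.character g⁻¹ = (Nat.card G : charField χ) := by
    apply (algebraMap (charField χ) ℂ).injective
    rw [map_sum, map_natCast, ← hs']
    refine Finset.sum_congr rfl fun g _ => ?_
    rw [map_mul, hτ, hτ, ← hρ, ← hρ]
    rfl
  have hcc : ∀ g, charConj hχα (ρ.character g) = ρ.character (α g) := fun g =>
    Subtype.ext (by rw [coe_charConj, hρ, hρ, hχα])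
  have hαα : ∀ g, α (α g) = g := fun g => by
    have := congrArg (fun β : MulAut G => β g) hα
    simpa [pow_two] using this
  -- Were `χ` real, its norm `|G|` would be `∑ χ²`, which indicator `o` makes zero.
  obtain ⟨g₀, hg₀⟩ : ∃ g, χ (α g) ≠ χ g := by
    by_contra! hreal
    have h0 := sum_sq_eq_zero_of_indicatorO hχ hχo hinv
    have : ∑ g, χ g * χ g = (Nat.card G : ℂ) := by
      rw [← hs']
      refine Finset.sum_congr rfl fun g _ => ?_
      rw [hτ, hτ, hinv, ← hχα, hreal]
    exact Nat.cast_ne_zero.2 Nat.card_pos.ne' (this.symm.trans h0)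
  refine ⟨ρ.character g₀ - ρ.character (α g₀), ?_⟩
  exact
    { mem_iff := fun x => (mem_realField_iff x).trans
        ⟨fun h => Subtype.ext h, fun h => congrArg Subtype.val h⟩
      invol := fun x => Subtype.ext (by rw [coe_charConj, coe_charConj, Complex.conj_conj])
      conj_delta := by rw [map_sub, hcc, hcc, hαα, neg_sub]
      delta_ne_zero := fun h => hg₀ (by rw [← hρ, ← hρ, sub_eq_zero.1 h])
      sum_char := hs
      sq_eq_one := hα
      char_twist := fun g => Subtype.ext (by rw [hρ, hρ, hχα, hinv])
      conj_char := hcc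
      delta_smul_mem := smul_sub_mem_fixedSpan hs hα g₀ }

/-- The twisted sum, computed over `ℂ`, identifies the sign of the form over `L` as `+1`. -/
theorem ConjugateTwist.exists_symm_form {δ : charField χ} (hχα : ∀ g, χ (α g) = conj (χ g))
    (D : ConjugateTwist (realField χ) (charConj hχα) δ ρ α)
    (hρ : ∀ g, ((ρ.character g : charField χ) : ℂ) = χ g)
    (hsum : ∑ g, χ (g * α g) = Nat.card G) :
    ∃ B : LinearMap.BilinForm (charField χ) V, B ≠ 0 ∧ TwistedInvariant ρ α B ∧ B.flip = B := by
  obtain ⟨B, hB0, hB⟩ := exists_twistedInvariant D.sum_char D.char_twist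
  obtain ⟨ε, -, hε⟩ := hB.flip_eq D.sum_char D.char_twist hB0 D.sq_eq_one
  refine ⟨B, hB0, hB, ?_⟩
  have h := congrArg (algebraMap (charField χ) ℂ) (hB.sum_char D.sum_char hB0 hε)
  have h1 : algebraMap (charField χ) ℂ (∑ g, ρ.character (g * α g)) = Nat.card G := by
    rw [map_sum, ← hsum]
    exact Finset.sum_congr rfl fun g _ => hρ _
  rw [h1, map_mul, map_natCast, eq_comm, mul_eq_right₀ (Nat.cast_ne_zero.2 Nat.card_pos.ne')] at h
  have hε1 : ε = 1 := (algebraMap (charField χ) ℂ).injective (h.trans (map_one _).symm)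
  rw [hε, hε1, one_smul]

end CharacterField

end AlphaDisc
end

/-! ### The main theorem -/

theorem mainTheorem6 {G : Type*} [Group G] [Finite G] (χ : G → ℂ)
    (hχ : AlphaDisc.IsIrrChar χ) (hχo : AlphaDisc.IndicatorO χ) (hχ2 : ∃ m : ℕ, χ 1 = 2 * m)
    {V : Type*} [AddCommGroup V] [Module (AlphaDisc.charField χ) V]
    [FiniteDimensional (AlphaDisc.charField χ) V]
    (ρ : Representation (AlphaDisc.charField χ) G V)
    (hρ : ∀ g, ((ρ.character g : AlphaDisc.charField χ) : ℂ) = χ g)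
    (H : V → V → AlphaDisc.charField χ) (hH : AlphaDisc.IsInvariantHermitian ρ H)
    (α : MulAut G) (hα : α ^ 2 = 1) (hχα : ∀ g, χ (α g) = (starRingEnd ℂ) (χ g))
    (hplus : AlphaDisc.IndicatorPlus (AlphaDisc.inducedChar χ α)) :
    (∃ d₀ : (AlphaDisc.realField χ)ˣ,
      AlphaDisc.alphaDisc χ ρ H α hα = {d | ∃ s : (AlphaDisc.realField χ)ˣ, d = d₀ * s ^ 2}) ∧
    ∀ d ∈ AlphaDisc.alphaDisc χ ρ H α hα,
      ∀ v : IsDedekindDomain.HeightOneSpectrum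
          (NumberField.RingOfIntegers (AlphaDisc.realField χ)),
        AlphaDisc.RamifiesIn v (AlphaDisc.quadAlgebra (d : AlphaDisc.realField χ)) →
        v.asIdeal ∣ Ideal.span
          {(2 * Nat.card G : NumberField.RingOfIntegers (AlphaDisc.realField χ))} := by
  have := Fintype.ofFinite G
  obtain ⟨m, hm⟩ := hχ2
  obtain ⟨δ, D⟩ := hχ.exists_conjugateTwist hχo hρ hH hα hχα
  have hinv := hH.apply_inv hχα hρ
  have hsum := AlphaDisc.sum_twisted_of_indicatorPlus hχ
    (AlphaDisc.sum_sq_eq_zero_of_indicatorO hχ hχo hinv) hinv α hα hχα hplus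
  obtain ⟨B, hB0, hB, hsymm⟩ := D.exists_symm_form hχα hρ hsum
  have hH' := hH.hermitianFor hχα
  have hfin : Module.finrank (AlphaDisc.charField χ) V = 2 * m := by
    have h := hρ 1
    rw [Representation.char_one, hm] at h
    have h1 := (map_natCast (algebraMap (AlphaDisc.charField χ) ℂ) _).symm.trans h
    exact_mod_cast h1
  refine ⟨D.exists_discClass_eq hB hB0 hsymm hH' hfin, fun d hd v hram => ?_⟩
  have := AlphaDisc.numberField_charField hχ
  have := AlphaDisc.numberField_realField hχ
  rw [Ideal.dvd_span_singleton]
  by_contra hv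
  have h2 : (2 : NumberField.RingOfIntegers (AlphaDisc.realField χ)) ∉ v.asIdeal :=
    fun h => hv (Ideal.mul_mem_right _ _ h)
  have hN : (Nat.card G : NumberField.RingOfIntegers (AlphaDisc.realField χ)) ∉ v.asIdeal :=
    fun h => hv (Ideal.mul_mem_left _ _ h)
  -- Since `w` is unramified over `v`, the parity of the valuation of `d` may be computed in `L`,
  -- where the form `B` lives.
  obtain ⟨w, hw, hwv⟩ := AlphaDisc.exists_prime_over_charField hχ v hN
  have hval : w.valuation (AlphaDisc.charField χ) (Nat.card G : AlphaDisc.charField χ) = 1 := by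
    have h := w.valuation_of_algebraMap (K := AlphaDisc.charField χ)
      (Nat.card G : NumberField.RingOfIntegers (AlphaDisc.charField χ))
    rw [w.intValuation_eq_one_iff.2 hw] at h
    have hcast : algebraMap (NumberField.RingOfIntegers (AlphaDisc.charField χ))
        (AlphaDisc.charField χ) (Nat.card G) = Nat.card G := map_natCast _ _
    exact (congrArg _ hcast.symm).trans h
  have hsq := D.isSquare_valuation_of_mem_discClass hB hB0 hsymm hH' hfin
    (w.valuation (AlphaDisc.charField χ)) hval hd
  rw [hwv] at hsq
  exact AlphaDisc.not_ramifiesIn_of_isSquare_valuation v d.ne_zero h2 hsq hram
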